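/- Let $H$ be a separable complex Hilbert space with an orthonormal basis $(e_i)$, let $\mathcal T(H)$ be the trace class operators on $H$, so that $B(H)=\mathcal T(H)^*$, and call $s\in\mathcal T(H)$ a state if $s\ge 0$ and $\operatorname{tr}(s)=1$. Let $X$ be a set with a $\sigma$-algebra $\mathcal O(X)$, and let $\nu:\mathcal O(X)\to B(H)$ be a positive operator-valued measure (POVM), i.e. $\nu(E)\ge 0$ for all $E$ and $\nu(\bigcup_k E_k)=\sum_k\nu(E_k)$ in the weak$^*$ (ultraweak) topology for pairwise disjoint $E_1,E_2,\dots\in\mathcal O(X)$. Let $\rho$ be a full-rank (injective) state and $\nu_\rho(E)=\operatorname{tr}(\rho\,\nu(E))$. Suppose that the Radon–Nikodým derivative $D=\frac{d\nu}{d\nu_\rho}$ exists. This means that there is a function $D:X\to B(H)$ such that $x\mapsto\operatorname{tr}(sD(x))$ is measurable for every state $s$, each $x\mapsto\langle D(x)e_j,e_i\rangle$ is $\nu_\rho$-integrable, and $\langle\nu(E)e_j,e_i\rangle=\int_E\langle D(x)e_j,e_i\rangle\,d\nu_\rho(x)$ for all $i,j$ and all $E\in\mathcal O(X)$. For a $\nu$-integrable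 function $f:X\to B(H)$ let $\mathcal E_\nu(f)=\int_X f\,d\nu\in B(H)$ be the operator with $$\operatorname{tr}\big(s\,\mathcal E_\nu(f)\big)=\int_X\operatorname{tr}\big(s\,D(x)^{1/2}f(x)D(x)^{1/2}\big)\,d\nu_\rho(x)\quad\text{for all states } s.$$ Here $f$ is assumed to be such that $x\mapsto\operatorname{tr}(sf(x))$ is measurable for all states $s$, and it is called $\nu$-integrable if, for each $g$ among $(\operatorname{Re}f)_\pm,(\operatorname{Im}f)_\pm$ and each state $s$, the function $x\mapsto\operatorname{tr}(s\,D(x)^{1/2}g(x)D(x)^{1/2})$ is $\nu_\rho$-integrable. Assume that 1. $\nu$ is nonatomic: there is no $E\in\mathcal O(X)$ with $\nu(E)\ne0$ such that every $F\in\mathcal O(X)$ with $F\subseteq E$ satisfies $\nu(F)=0$ or $\nu(F)=\nu(E)$; 2. integration against $\nu$ is classically non-injective: for every $E\in\mathcal O(X)$ with $\nu(E)\neq0$ the map $L^\infty(E,\nu)\to B(H)$, $f\mapsto\mathcal E_\nu(fI)$, is not injective, where $L^\infty(E,\nu)$ consists of the $\nu$-essentially bounded measurable $f:X\to\mathbb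 C$ vanishing outside $E$, modulo equality $\nu$-almost everywhere. Then the range $\mathcal R_\nu=\{\nu(E):E\in\mathcal O(X)\}$ is a convex and weak$^*$-compact subset of $B(H)$. Moreover, for every measurable $h:X\to[0,1]$ the integral $\mathcal E_\nu(hI)$ exists and is uniquely determined, and $$\mathcal R_\nu=\{\mathcal E_\nu(hI)\;:\;h:X\to[0,1]\text{ measurable}\}.$$ -/

import Mathlib

open MeasureTheory Filter Topology
open scoped InnerProductSpace ComplexStarModule ComplexOrder

namespace OperatorMeasure

variable {ι H X : Type*} [NormedAddCommGroup H] [InnerProductSpace ℂ H] [CompleteSpace H]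

/-! ### Trace, trace class operators, states and the weak-star topology of `B(H)`

An orthonormal basis `e` of `H` is fixed throughout; the trace, the trace class and the
topology below do not depend on it. -/

/-- The trace `∑ᵢ ⟨A eᵢ, eᵢ⟩` (the inner product of Mathlib is linear in the second slot). It is
only applied to products of a trace class operator with bounded operators, where the series
converges absolutely. -/
noncomputable def trace (e : HilbertBasis ι ℂ H) (A : H →L[ℂ] H) : ℂ :=
  ∑' i, ⟪e i, A (e i)⟫_ℂ

/-- The trace class `T(H)`: the linear span of the positive operators of finite trace. -/
def traceClass (e : HilbertBasis ι ℂ H) : Submodule ℂ (H →L[ℂ] H) :=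
  Submodule.span ℂ {T | 0 ≤ T ∧ Summable fun i => ⟪e i, T (e i)⟫_ℂ}

/-- The weak-star (ultraweak) topology on `B(H)`, the dual of `T(H)`: the coarsest topology for
which `A ↦ tr(T A)` is continuous for every trace class operator `T`. -/
@[reducible] noncomputable def ultraweak (e : HilbertBasis ι ℂ H) : TopologicalSpace (H →L[ℂ] H) :=
  ⨅ T : traceClass e,
    TopologicalSpace.induced (fun A => trace e ((T : H →L[ℂ] H) * A)) inferInstance

/-- States (density operators): positive operators of trace one. -/
structure State (e : HilbertBasis ι ℂ H) where
  op : H →L[ℂ] H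
  nonneg : 0 ≤ op
  hasSum_one : HasSum (fun i => ⟪e i, op (e i)⟫_ℂ) 1

/-- A state has full rank if it is injective (equivalently, being self-adjoint, it has dense
range). -/
def State.FullRank {e : HilbertBasis ι ℂ H} (ρ : State e) : Prop :=
  Function.Injective ρ.op

/-! ### Positive operator valued measures -/

/-- A positive operator-valued measure on a measurable space `X`: a map from the measurable sets
to positive operators (values on non-measurable sets are never used) which is countably additive
in the ultraweak topology. -/
structure POVM (X : Type*) [MeasurableSpace X] (e : HilbertBasis ι ℂ H) where
  toFun : Set X → (H →L[ℂ] H)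
  nonneg : ∀ E, MeasurableSet E → 0 ≤ toFun E
  tendsto_sum : ∀ E : ℕ → Set X, (∀ k, MeasurableSet (E k)) →
    (∀ j k, j ≠ k → E j ∩ E k = ∅) →
    Tendsto (fun n => ∑ k ∈ Finset.range n, toFun (E k)) atTop
      (@nhds _ (ultraweak e) (toFun (⋃ k, E k)))

instance [MeasurableSpace X] (e : HilbertBasis ι ℂ H) :
    CoeFun (POVM X e) (fun _ => Set X → (H →L[ℂ] H)) := ⟨POVM.toFun⟩

/-! ### Facts needed to build the scalar measure `E ↦ tr(ρ ν(E))` -/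

set_option linter.unusedSectionVars false

theorem hasSum_norm_sq (e : HilbertBasis ι ℂ H) (x : H) :
    HasSum (fun i => ‖⟪x, e i⟫_ℂ‖ ^ 2) (‖x‖ ^ 2) := by
  have h := Complex.hasSum_re (e.hasSum_inner_mul_inner x x)
  have h1 : (fun i => (⟪x, e i⟫_ℂ * ⟪e i, x⟫_ℂ).re) = fun i => ‖⟪x, e i⟫_ℂ‖ ^ 2 := by
    funext i
    rw [← inner_conj_symm (e i) x, Complex.mul_conj, Complex.ofReal_re, Complex.normSq_eq_norm_sq]
  have h2 : (⟪x, x⟫_ℂ).re = ‖x‖ ^ 2 := inner_self_eq_norm_sq (𝕜 := ℂ) x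
  rw [h1, h2] at h
  exact h

/-- If `B` is self-adjoint and Hilbert–Schmidt then `tr(B B A)` converges and equals
`tr(B A B)`. -/
theorem exists_hasSum_swap (e : HilbertBasis ι ℂ H) {B : H →L[ℂ] H} (hB : IsSelfAdjoint B)
    (hs : Summable fun i => ‖B (e i)‖ ^ 2) (A : H →L[ℂ] H) :
    ∃ t : ℂ, HasSum (fun i => ⟪e i, (B * B * A) (e i)⟫_ℂ) t ∧
      HasSum (fun j => ⟪B (e j), A (B (e j))⟫_ℂ) t := by
  have hsym : ∀ x y, ⟪B x, y⟫_ℂ = ⟪x, B y⟫_ℂ := fun x y => by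
    conv_lhs => rw [← hB.adjoint_eq]
    exact ContinuousLinearMap.adjoint_inner_left _ _ _
  set A' := ContinuousLinearMap.adjoint A with hA'
  let F : ι × ι → ℂ := fun p => ⟪B (e p.1), e p.2⟫_ℂ * ⟪A' (B (e p.2)), e p.1⟫_ℂ
  have hprod : ∀ C : H →L[ℂ] H, (Summable fun i => ‖C (e i)‖ ^ 2) →
      Summable fun p : ι × ι => ‖⟪C (e p.1), e p.2⟫_ℂ‖ ^ 2 := fun C hC => by
    refine (summable_prod_of_nonneg fun p => by positivity).2
      ⟨fun i => (hasSum_norm_sq e (C (e i))).summable, ?_⟩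
    simpa only [(hasSum_norm_sq e _).tsum_eq] using hC
  have h1 := hprod B hs
  have h2' : Summable fun i => ‖(A' * B) (e i)‖ ^ 2 := by
    refine Summable.of_nonneg_of_le (fun i => by positivity) (fun i => ?_) (hs.mul_left (‖A'‖ ^ 2))
    rw [← mul_pow]
    exact pow_le_pow_left₀ (norm_nonneg _) (A'.le_opNorm _) 2
  have h2 := (Equiv.prodComm ι ι).summable_iff.2 (hprod (A' * B) h2')
  have hF : Summable F := by
    refine Summable.of_norm (Summable.of_nonneg_of_le (fun _ => norm_nonneg _) (fun p => ?_)
      (h1.add h2))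
    simp only [F, norm_mul, Function.comp, Equiv.prodComm_apply, Prod.fst_swap, Prod.snd_swap,
      mul_apply_eq_comp]
    nlinarith [sq_nonneg (‖⟪B (e p.1), e p.2⟫_ℂ‖ - ‖⟪A' (B (e p.2)), e p.1⟫_ℂ‖),
      sq_nonneg (‖⟪B (e p.1), e p.2⟫_ℂ‖), sq_nonneg (‖⟪A' (B (e p.2)), e p.1⟫_ℂ‖)]
  have hF2 := (Equiv.prodComm ι ι).hasSum_iff.2 hF.hasSum
  refine ⟨∑' p, F p, hF.hasSum.prod_fiberwise fun i => ?_, hF2.prod_fiberwise fun j => ?_⟩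
  · have h := e.hasSum_inner_mul_inner (B (e i)) (B (A (e i)))
    have h3 : ∀ j, ⟪e j, B (A (e i))⟫_ℂ = ⟪A' (B (e j)), e i⟫_ℂ := fun j => by
      rw [← hsym, hA', ContinuousLinearMap.adjoint_inner_left]
    simp only [h3] at h
    rw [hsym] at h
    exact h
  · have h := e.hasSum_inner_mul_inner (A' (B (e j))) (B (e j))
    have h3 : ∀ i, ⟪e i, B (e j)⟫_ℂ = ⟪B (e i), e j⟫_ℂ := fun i => (hsym _ _).symm
    simp only [h3] at h
    have h4 : ⟪A' (B (e j)), B (e j)⟫_ℂ = ⟪B (e j), A (B (e j))⟫_ℂ := by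
      rw [hA', ContinuousLinearMap.adjoint_inner_left]
    rw [h4] at h
    simpa only [F, Function.comp, Equiv.prodComm_apply, Prod.fst_swap, Prod.snd_swap, mul_comm]
      using h

/-- For `T ≥ 0` of finite trace, `tr(T A) = tr(T^{1/2} A T^{1/2})`. -/
theorem exists_hasSum_pos (e : HilbertBasis ι ℂ H) {T : H →L[ℂ] H} (hT : 0 ≤ T)
    (hs : Summable fun i => ⟪e i, T (e i)⟫_ℂ) (A : H →L[ℂ] H) :
    ∃ t : ℂ, HasSum (fun i => ⟪e i, (T * A) (e i)⟫_ℂ) t ∧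
      HasSum (fun j => ⟪CFC.sqrt T (e j), A (CFC.sqrt T (e j))⟫_ℂ) t := by
  have hB : IsSelfAdjoint (CFC.sqrt T) := (CFC.sqrt_nonneg T).isSelfAdjoint
  have hBB := CFC.sqrt_mul_sqrt_self T hT
  have h := exists_hasSum_swap e hB ?_ A
  · rwa [hBB] at h
  · have h2 := (Complex.hasSum_re hs.hasSum).summable
    refine h2.congr fun i => ?_
    have h3 : ⟪e i, T (e i)⟫_ℂ = ⟪CFC.sqrt T (e i), CFC.sqrt T (e i)⟫_ℂ := by
      conv_lhs => rw [← hBB, mul_apply_eq_comp]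
      conv_rhs => rw [← hB.adjoint_eq, ContinuousLinearMap.adjoint_inner_left, hB.adjoint_eq]
    rw [h3]
    exact inner_self_eq_norm_sq (𝕜 := ℂ) _

theorem summable_trace (e : HilbertBasis ι ℂ H) {T : H →L[ℂ] H} (hT : T ∈ traceClass e)
    (A : H →L[ℂ] H) : Summable fun i => ⟪e i, (T * A) (e i)⟫_ℂ := by
  induction hT using Submodule.span_induction with
  | mem T h => exact (exists_hasSum_pos e h.1 h.2 A).choose_spec.1.summable
  | zero => simp
  | add S T _ _ hS hT =>
    refine (hS.add hT).congr fun i => ?_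
    rw [add_mul, add_apply, inner_add_right]
  | smul c T _ hT =>
    refine (hT.mul_left c).congr fun i => ?_
    rw [smul_mul_assoc, smul_apply, inner_smul_right]

theorem trace_nonneg (e : HilbertBasis ι ℂ H) {T A : H →L[ℂ] H} (hT : 0 ≤ T)
    (hs : Summable fun i => ⟪e i, T (e i)⟫_ℂ) (hA : 0 ≤ A) : 0 ≤ trace e (T * A) := by
  obtain ⟨t, h1, h2⟩ := exists_hasSum_pos e hT hs A
  rw [trace, h1.tsum_eq, ← h2.tsum_eq]
  exact tsum_nonneg fun j =>
    ((ContinuousLinearMap.nonneg_iff_isPositive A).1 hA).inner_nonneg_right _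

theorem trace_mul_sum (e : HilbertBasis ι ℂ H) {T : H →L[ℂ] H} (hT : T ∈ traceClass e)
    (s : Finset ℕ) (A : ℕ → (H →L[ℂ] H)) :
    trace e (T * ∑ k ∈ s, A k) = ∑ k ∈ s, trace e (T * A k) := by
  simp only [trace]
  rw [← Summable.tsum_finsetSum fun k _ => summable_trace e hT (A k)]
  refine tsum_congr fun i => ?_
  rw [Finset.mul_sum, sum_apply, inner_sum]

theorem State.mem_traceClass {e : HilbertBasis ι ℂ H} (ρ : State e) : ρ.op ∈ traceClass e :=
  Submodule.subset_span ⟨ρ.nonneg, ρ.hasSum_one.summable⟩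

theorem continuous_trace_mul (e : HilbertBasis ι ℂ H) {T : H →L[ℂ] H} (hT : T ∈ traceClass e) :
    @Continuous _ _ (ultraweak e) _ fun A => trace e (T * A) :=
  continuous_iInf_dom (i := (⟨T, hT⟩ : traceClass e)) continuous_induced_dom

namespace POVM

variable [MeasurableSpace X] {e : HilbertBasis ι ℂ H} (ν : POVM X e)

theorem trace_nonneg (ρ : State e) {E : Set X} (hE : MeasurableSet E) :
    0 ≤ trace e (ρ.op * ν E) :=
  OperatorMeasure.trace_nonneg e ρ.nonneg ρ.hasSum_one.summable (ν.nonneg E hE)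

theorem hasSum_trace_re (ρ : State e) {E : ℕ → Set X} (hE : ∀ k, MeasurableSet (E k))
    (hd : ∀ j k, j ≠ k → E j ∩ E k = ∅) :
    HasSum (fun k => (trace e (ρ.op * ν (E k))).re) (trace e (ρ.op * ν (⋃ k, E k))).re := by
  rw [hasSum_iff_tendsto_nat_of_nonneg fun k =>
    (Complex.nonneg_iff.1 (ν.trace_nonneg ρ (hE k))).1]
  have h := ((@Continuous.tendsto _ _ (ultraweak e) _ _
    (continuous_trace_mul e ρ.mem_traceClass) _).comp (ν.tendsto_sum E hE hd))
  have h2 := (Complex.continuous_re.tendsto _).comp h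
  simpa only [Function.comp_def, trace_mul_sum e ρ.mem_traceClass, Complex.re_sum] using h2

/-- The finite positive measure `ν_ρ(E) = tr(ρ ν(E))`. -/
noncomputable def scalar (ρ : State e) : Measure X :=
  Measure.ofMeasurable (fun E _ => ENNReal.ofReal (trace e (ρ.op * ν E)).re)
    (by
      have h := ν.hasSum_trace_re ρ (E := fun _ => ∅) (fun _ => MeasurableSet.empty) (by simp)
      have h0 := (summable_const_iff _).1 h.summable
      simp [h0])
    (fun E hE hd => by
      have h := ν.hasSum_trace_re ρ hE (fun j k hjk => (hd hjk).inter_eq)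
      rw [← h.tsum_eq]
      exact ENNReal.ofReal_tsum_of_nonneg
        (fun k => (Complex.nonneg_iff.1 (ν.trace_nonneg ρ (hE k))).1) h.summable)

theorem scalar_apply (ρ : State e) {E : Set X} (hE : MeasurableSet E) :
    (((ν.scalar ρ).real E : ℝ) : ℂ) = trace e (ρ.op * ν E) := by
  have h := Complex.nonneg_iff.1 (ν.trace_nonneg ρ hE)
  rw [Measure.real, scalar, Measure.ofMeasurable_apply E hE, ENNReal.toReal_ofReal h.1]
  exact Complex.ext rfl h.2

/-- `ν` is nonatomic: no measurable `E` with `ν(E) ≠ 0` is such that every measurable `F ⊆ E` has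
`ν(F) = 0` or `ν(F) = ν(E)`. -/
def Nonatomic : Prop :=
  ¬ ∃ E, MeasurableSet E ∧ ν E ≠ 0 ∧
    ∀ F, MeasurableSet F → F ⊆ E → ν F = 0 ∨ ν F = ν E

end POVM

/-! ### Quantum random variables, the Radon–Nikodým derivative and the integral -/

section Integral

variable [MeasurableSpace X] {e : HilbertBasis ι ℂ H}

/-- A quantum random variable: `x ↦ tr(s f(x))` is measurable for every state `s`. -/
def IsQuantumRandomVariable (e : HilbertBasis ι ℂ H) (f : X → (H →L[ℂ] H)) : Prop :=
  ∀ s : State e, Measurable fun x => trace e (s.op * f x)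

/-- `D` is (a version of) the Radon–Nikodým derivative `dν/dν_ρ`: it is a quantum random variable,
so in particular takes values in the bounded operators, and its matrix entries are the classical
Radon–Nikodým derivatives of the matrix entries `ν_{ij}(E) = ⟨ν(E) e_j, e_i⟩` with respect to
`ν_ρ`. The derivative exists if there is such a `D`. -/
structure IsRNDeriv (ν : POVM X e) (ρ : State e) (D : X → (H →L[ℂ] H)) : Prop where
  isQuantumRandomVariable : IsQuantumRandomVariable e D
  integrable : ∀ i j, Integrable (fun x => ⟪e i, D x (e j)⟫_ℂ) (ν.scalar ρ)
  setIntegral_eq : ∀ i j E, MeasurableSet E →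
    ⟪e i, ν E (e j)⟫_ℂ = ∫ x in E, ⟪e i, D x (e j)⟫_ℂ ∂(ν.scalar ρ)

/-- The function `f_s(x) = tr(s D(x)^{1/2} f(x) D(x)^{1/2})`. -/
noncomputable def sandwich (D : X → (H →L[ℂ] H)) (s : State e) (f : X → (H →L[ℂ] H)) (x : X) : ℂ :=
  trace e (s.op * (CFC.sqrt (D x) * f x * CFC.sqrt (D x)))

/-- Integrability of a positive quantum random variable `f`: every `f_s` is `ν_ρ`-integrable. -/
def PosIntegrable (ν : POVM X e) (ρ : State e) (D f : X → (H →L[ℂ] H)) : Prop :=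
  ∀ s : State e, Integrable (sandwich D s f) (ν.scalar ρ)

/-- `f` is `ν`-integrable if `(Re f)₊`, `(Re f)₋`, `(Im f)₊` and `(Im f)₋` are. -/
def QIntegrable (ν : POVM X e) (ρ : State e) (D f : X → (H →L[ℂ] H)) : Prop :=
  PosIntegrable ν ρ D (fun x => (ℜ (f x) : H →L[ℂ] H)⁺) ∧
  PosIntegrable ν ρ D (fun x => (ℜ (f x) : H →L[ℂ] H)⁻) ∧
  PosIntegrable ν ρ D (fun x => (ℑ (f x) : H →L[ℂ] H)⁺) ∧
  PosIntegrable ν ρ D (fun x => (ℑ (f x) : H →L[ℂ] H)⁻)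

/-- `HasQIntegral ν ρ D f A` says that `f` is a `ν`-integrable quantum random variable with integral
`ℰ_ν(f) = ∫ f dν = A`, that is, `tr(s A) = ∫ f_s dν_ρ` for every state `s`. Here `D = dν/dν_ρ`. -/
structure HasQIntegral (ν : POVM X e) (ρ : State e) (D f : X → (H →L[ℂ] H)) (A : H →L[ℂ] H) :
    Prop where
  isQuantumRandomVariable : IsQuantumRandomVariable e f
  integrable : QIntegrable ν ρ D f
  trace_eq : ∀ s : State e, trace e (s.op * A) = ∫ x, sandwich D s f x ∂(ν.scalar ρ)

/-- `f` represents an element of the scalar space `L^∞(E, ν)`: it is measurable, it is extended by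
zero outside `E`, and it is essentially bounded with respect to `ν`. -/
structure IsLInfty (ν : POVM X e) (E : Set X) (f : X → ℂ) : Prop where
  measurable : Measurable f
  eq_zero : ∀ x, x ∉ E → f x = 0
  essBounded : ∃ M : ℝ, ν {x | M < ‖f x‖} = 0

/-- Integration against `ν` is classically non-injective: for every measurable `E` with `ν(E) ≠ 0`,
the map `f ∈ L^∞(E, ν) ↦ ℰ_ν(f I)` is not injective, i.e. it takes the same value at two functions
which are not `ν`-almost everywhere equal. -/
def ClassicallyNonInjective (ν : POVM X e) (ρ : State e) (D : X → (H →L[ℂ] H)) : Prop :=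
  ∀ E, MeasurableSet E → ν E ≠ 0 →
    ∃ f g : X → ℂ, IsLInfty ν E f ∧ IsLInfty ν E g ∧ ν {x | f x ≠ g x} ≠ 0 ∧
      ∃ A : H →L[ℂ] H, HasQIntegral ν ρ D (fun x => f x • 1) A ∧
        HasQIntegral ν ρ D (fun x => g x • 1) A

end Integral

end OperatorMeasure

/-! ### The dual of `L¹` of a finite measure -/

section DualL1

open scoped ENNReal

variable {X : Type*} [MeasurableSpace X] {μ : Measure X}

/-! The argument is Lindenstrauss's proof of Lyapunov's convexity theorem. Modulo null sets, the
measurable functions `h : X → [0,1]` form a convex weak-star compact subset of `L^∞(ν_ρ) =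
L¹(ν_ρ)*`. The map `h ↦ ∫ h dν` is affine and continuous into the ultraweak topology, because each
pairing `tr(T ∫ h dν) = ∫ h tr(T D) dν_ρ` tests `h` against a fixed `L¹` function. Its image is
therefore convex and compact, and it remains to attain each value at an indicator function.

The functions with a prescribed integral form a nonempty compact convex set, which has an extreme
point `g` by Krein–Milman. If `g` were not an indicator, some `{ε ≤ g ≤ 1 - ε}` would have positive
measure. Non-injectivity there gives a nonzero bounded function supported on this set with integral
zero; scaled to `v` with `|v| ≤ ε`, it puts `g ± v` in the same fibre, against extremality. This is
`exists_setIntegral_eq`.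

The operator theory reduces the problem to scalar integrals. Full rank of `ρ` gives `ν` and `ν_ρ`
the same null sets. Separability gives `D ≥ 0` almost everywhere, so that `D^{1/2} (h I) D^{1/2} = h
D`. The matrix entry identities for `D` extend to all vectors (`exists_inner_eq_integral`), then to
trace class operators (`integrable_trace_and_trace_eq`). -/

theorem integrable_bdd_mul {g f : X → ℝ} (hg : Measurable g) {r : ℝ} (hr : ∀ x, |g x| ≤ r)
    (hf : Integrable f μ) : Integrable (fun x => g x * f x) μ :=
  hf.bdd_mul hg.aestronglyMeasurable (c := r) (ae_of_all _ hr)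

/-- Integration against a bounded measurable function, as a functional on `L¹`. -/
noncomputable def boundedPairing (μ : Measure X) {g : X → ℝ} (hg : Measurable g) {r : ℝ}
    (hr : ∀ x, |g x| ≤ r) : StrongDual ℝ (Lp ℝ 1 μ) :=
  LinearMap.mkContinuous
    { toFun := fun f => ∫ x, g x * f x ∂μ
      map_add' := fun f₁ f₂ => by
        rw [← integral_add (integrable_bdd_mul hg hr (L1.integrable_coeFn f₁))
          (integrable_bdd_mul hg hr (L1.integrable_coeFn f₂))]
        refine integral_congr_ae ?_
        filter_upwards [Lp.coeFn_add f₁ f₂] with x hx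
        rw [hx, Pi.add_apply, mul_add]
      map_smul' := fun c f => by
        rw [RingHom.id_apply, smul_eq_mul, ← integral_const_mul]
        refine integral_congr_ae ?_
        filter_upwards [Lp.coeFn_smul c f] with x hx
        rw [hx, Pi.smul_apply, smul_eq_mul, mul_left_comm] } r
    fun f => by
      rw [L1.norm_eq_integral_norm, ← integral_const_mul]
      refine norm_integral_le_of_norm_le ((L1.integrable_coeFn f).norm.const_mul r)
        (ae_of_all _ fun x => ?_)
      rw [norm_mul]
      exact mul_le_mul_of_nonneg_right (hr x) (norm_nonneg _)

theorem boundedPairing_apply {g : X → ℝ} (hg : Measurable g) {r : ℝ} (hr : ∀ x, |g x| ≤ r)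
    (f : Lp ℝ 1 μ) : boundedPairing μ hg hr f = ∫ x, g x * f x ∂μ := rfl

theorem boundedPairing_toLp {g : X → ℝ} (hg : Measurable g) {r : ℝ} (hr : ∀ x, |g x| ≤ r)
    {f : X → ℝ} (hf : Integrable f μ) :
    boundedPairing μ hg hr (hf.toL1 f) = ∫ x, g x * f x ∂μ := by
  rw [boundedPairing_apply]
  refine integral_congr_ae ?_
  filter_upwards [hf.coeFn_toL1] with x hx
  rw [hx]

theorem norm_boundedPairing_le {g : X → ℝ} (hg : Measurable g) {r : ℝ} (hr : ∀ x, |g x| ≤ r)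
    (h0 : 0 ≤ r) : ‖boundedPairing μ hg hr‖ ≤ r :=
  LinearMap.mkContinuous_norm_le _ h0 _

/-- Every functional on `L¹` of a finite measure is integration against a function bounded by the
norm of the functional. -/
theorem exists_eq_boundedPairing [IsFiniteMeasure μ] (ψ : StrongDual ℝ (Lp ℝ 1 μ)) {r : ℝ}
    (h0 : 0 ≤ r) (hψ : ‖ψ‖ ≤ r) :
    ∃ (g : X → ℝ) (hg : Measurable g) (hr : ∀ x, |g x| ≤ r), ψ = boundedPairing μ hg hr := by
  have : ENNReal.HolderTriple 2 2 1 := ⟨by simpa using ENNReal.inv_two_add_inv_two⟩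
  -- As `μ` is finite, multiplication by the constant `1` in `L²` is the inclusion `J` of `L²` into
  -- `L¹`, and Riesz representation on `L²` turns `ψ ∘ J` into a function `G`.
  let one : Lp ℝ 2 μ := (memLp_const (1 : ℝ)).toLp (fun _ => 1)
  let J : Lp ℝ 2 μ →L[ℝ] Lp ℝ 1 μ := (ContinuousLinearMap.mul ℝ ℝ).holderL μ 2 2 1 one
  have hJ : ∀ f, J f =ᵐ[μ] f := fun f => by
    filter_upwards [(ContinuousLinearMap.mul ℝ ℝ).coeFn_holder (r := 1) one f,
      (memLp_const (1 : ℝ)).coeFn_toLp (μ := μ) (p := 2)] with x hx h1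
    change ((ContinuousLinearMap.mul ℝ ℝ).holder 1 one f) x = f x
    rw [hx, h1]
    simp
  let G : Lp ℝ 2 μ := (InnerProductSpace.toDual ℝ (Lp ℝ 2 μ)).symm (ψ ∘L J)
  have hG : ∀ f : Lp ℝ 2 μ, ψ (J f) = ∫ x, G x * f x ∂μ := fun f => by
    have h1 : ⟪G, f⟫_ℝ = ψ (J f) := InnerProductSpace.toDual_symm_apply
    rw [← h1, L2.inner_def]
    refine integral_congr_ae (ae_of_all _ fun x => ?_)
    simp [mul_comm]
  have hGi : Integrable G μ := (Lp.memLp G).integrable (by norm_num)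
  have hGE : ∀ (E : Set X) (hE : MeasurableSet E),
      ψ (indicatorConstLp 1 hE (measure_ne_top μ E) 1) = ∫ x in E, G x ∂μ := fun E hE => by
    have h1 : J (indicatorConstLp 2 hE (measure_ne_top μ E) 1)
        = indicatorConstLp 1 hE (measure_ne_top μ E) 1 := by
      refine Lp.ext ?_
      filter_upwards [hJ (indicatorConstLp 2 hE (measure_ne_top μ E) 1),
        indicatorConstLp_coeFn (p := 2) (hs := hE) (hμs := measure_ne_top μ E) (c := (1 : ℝ)),
        indicatorConstLp_coeFn (p := 1) (hs := hE) (hμs := measure_ne_top μ E) (c := (1 : ℝ))]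
        with x h1 h2 h3
      rw [h1, h2, h3]
    rw [← h1, hG, ← integral_indicator hE]
    refine integral_congr_ae ?_
    filter_upwards [indicatorConstLp_coeFn (p := 2) (hs := hE) (hμs := measure_ne_top μ E)
      (c := (1 : ℝ))] with x h2
    rw [h2]
    by_cases hx : x ∈ E <;> simp [hx]
  -- Testing `ψ` on indicators bounds all set integrals of `G` by `r μ(E)`, which forces `|G| ≤ r`
  -- almost everywhere.
  have hbd : ∀ (E : Set X), MeasurableSet E → |∫ x in E, G x ∂μ| ≤ ∫ x in E, r ∂μ :=
    fun E hE => by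
      rw [← hGE E hE]
      refine (ψ.le_opNorm _).trans ?_
      rw [norm_indicatorConstLp one_ne_zero ENNReal.one_ne_top]
      simp only [norm_one, ENNReal.toReal_one, div_one, Real.rpow_one, one_mul, setIntegral_const,
        smul_eq_mul]
      rw [mul_comm]
      exact mul_le_mul_of_nonneg_left hψ measureReal_nonneg
  have hle : G ≤ᵐ[μ] fun _ => r := ae_le_of_forall_setIntegral_le hGi (integrable_const _)
    fun E hE _ => (le_abs_self _).trans (hbd E hE)
  have hge : (fun _ => -r) ≤ᵐ[μ] G := ae_le_of_forall_setIntegral_le (integrable_const _) hGi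
    fun E hE _ => by
      rw [integral_neg]
      exact neg_le_of_abs_le (hbd E hE)
  let G' := (Lp.aestronglyMeasurable G).aemeasurable.mk G
  have hGm : Measurable G' := (Lp.aestronglyMeasurable G).aemeasurable.measurable_mk
  have hGG : G =ᵐ[μ] G' := (Lp.aestronglyMeasurable G).aemeasurable.ae_eq_mk
  -- Clamping upgrades the almost everywhere bound to one valid at every point.
  let g : X → ℝ := fun x => max (-r) (min r (G' x))
  have hg : Measurable g := measurable_const.max (measurable_const.min hGm)
  have hr : ∀ x, |g x| ≤ r := fun x =>
    abs_le.2 ⟨le_max_left _ _, max_le (by linarith) (min_le_left _ _)⟩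
  have hgG : g =ᵐ[μ] G := by
    filter_upwards [hle, hge, hGG] with x h1 h2 h3
    change max (-r) (min r (G' x)) = G x
    rw [← h3, min_eq_right h1, max_eq_right h2]
  refine ⟨g, hg, hr, ContinuousLinearMap.ext fun f => ?_⟩
  refine Lp.induction ENNReal.one_ne_top (motive := fun f => ψ f = boundedPairing μ hg hr f)
    (fun c E hE hμ => ?_) (fun f₁ f₂ h₁ h₂ _ e₁ e₂ => by rw [map_add, map_add, e₁, e₂])
    (isClosed_eq ψ.continuous (boundedPairing μ hg hr).continuous) f
  have h1 : (Lp.simpleFunc.indicatorConst 1 hE hμ.ne c : Lp ℝ 1 μ)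
      = c • indicatorConstLp 1 hE hμ.ne 1 := by
    rw [Lp.simpleFunc.coe_indicatorConst]
    refine Lp.ext ?_
    filter_upwards [Lp.coeFn_smul c (indicatorConstLp 1 hE hμ.ne (1 : ℝ)),
      indicatorConstLp_coeFn (p := 1) (hs := hE) (hμs := hμ.ne) (c := (1 : ℝ)),
      indicatorConstLp_coeFn (p := 1) (hs := hE) (hμs := hμ.ne) (c := c)] with x h1 h2 h3
    rw [h1, h3, Pi.smul_apply, h2]
    by_cases hx : x ∈ E <;> simp [hx]
  rw [h1, map_smul, map_smul, hGE E hE, boundedPairing_apply, ← integral_indicator hE]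
  congr 1
  refine integral_congr_ae ?_
  filter_upwards [indicatorConstLp_coeFn (p := 1) (hs := hE) (hμs := measure_ne_top μ E)
      (c := (1 : ℝ)), hgG] with x h2 h3
  rw [h2, h3]
  by_cases hx : x ∈ E <;> simp [hx]

end DualL1

/-! ### The weak-star compact set of measurable functions with values in `[0, 1]` -/

section UnitInterval

variable {X : Type*} [MeasurableSpace X] {μ : Measure X}

theorem abs_le_one_of_mem_Icc {t : ℝ} (ht : t ∈ Set.Icc (0 : ℝ) 1) : |t| ≤ 1 :=
  abs_le.2 ⟨by linarith [ht.1], ht.2⟩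

/-- The measurable functions with values in `[0, 1]`, as functionals on `L¹`. -/
def unitIntervalDual (μ : Measure X) : Set (WeakDual ℝ (Lp ℝ 1 μ)) :=
  {φ | ∃ (h : X → ℝ) (hm : Measurable h) (h01 : ∀ x, h x ∈ Set.Icc (0 : ℝ) 1),
    WeakDual.toStrongDual φ = boundedPairing μ hm fun x => abs_le_one_of_mem_Icc (h01 x)}

/-- A function lies in `[0,1]` exactly when it is within `1/2` of the constant `1/2`. Seen as a
closed dual ball, the set is compact by Banach–Alaoglu. -/
theorem unitIntervalDual_eq [IsFiniteMeasure μ] :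
    unitIntervalDual μ = WeakDual.toStrongDual ⁻¹' Metric.closedBall
      (boundedPairing μ (g := fun _ => 1 / 2) measurable_const (r := 1 / 2) fun _ => by norm_num)
      (1 / 2) := by
  ext φ
  rw [Set.mem_preimage, mem_closedBall_iff_norm]
  constructor
  · rintro ⟨h, hm, h01, hφ⟩
    have hb : ∀ x, |h x - 1 / 2| ≤ 1 / 2 := fun x =>
      abs_le.2 ⟨by linarith [(h01 x).1], by linarith [(h01 x).2]⟩
    have : WeakDual.toStrongDual φ -
        boundedPairing μ (g := fun _ => 1 / 2) measurable_const (r := 1 / 2) (fun _ => by norm_num)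
        = boundedPairing μ (hm.sub_const (1 / 2)) hb := by
      rw [hφ]
      ext f
      rw [sub_apply, boundedPairing_apply, boundedPairing_apply,
        boundedPairing_apply, ← integral_sub
          (integrable_bdd_mul hm (fun x => abs_le_one_of_mem_Icc (h01 x)) (L1.integrable_coeFn f))
          ((L1.integrable_coeFn f).const_mul _)]
      simp only [sub_mul]
    rw [this]
    exact norm_boundedPairing_le _ _ (by norm_num)
  · intro hφ
    obtain ⟨g, hg, hr, hψ⟩ := exists_eq_boundedPairing _ (by norm_num) hφ
    refine ⟨fun x => g x + 1 / 2, hg.add_const _, fun x => ?_, ?_⟩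
    · have := abs_le.1 (hr x)
      exact ⟨by linarith [this.1], by linarith [this.2]⟩
    · rw [sub_eq_iff_eq_add.1 hψ]
      ext f
      rw [add_apply, boundedPairing_apply, boundedPairing_apply,
        boundedPairing_apply, ← integral_add
          (integrable_bdd_mul hg hr (L1.integrable_coeFn f))
          ((L1.integrable_coeFn f).const_mul _)]
      simp only [add_mul]

theorem isCompact_unitIntervalDual [IsFiniteMeasure μ] : IsCompact (unitIntervalDual μ) := by
  rw [unitIntervalDual_eq]
  exact WeakDual.isCompact_closedBall _ _

/-- Each coordinate is built from weak-star evaluations at the real and imaginary parts of `d k`, so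
this is a continuous image of `unitIntervalDual`; the product topology allows any index type. -/
theorem isCompact_integrals [IsFiniteMeasure μ] {κ : Type*} {d : κ → X → ℂ}
    (hd : ∀ k, Integrable (d k) μ) :
    IsCompact {c : κ → ℂ | ∃ h : X → ℝ, Measurable h ∧ (∀ x, h x ∈ Set.Icc (0 : ℝ) 1) ∧
      ∀ k, c k = ∫ x, (h x : ℂ) * d k x ∂μ} := by
  let F : WeakDual ℝ (Lp ℝ 1 μ) → κ → ℂ := fun φ k =>
    ↑(φ ((hd k).re.toL1 _)) + ↑(φ ((hd k).im.toL1 _)) * Complex.I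
  have hF : Continuous F := continuous_pi fun k =>
    (Complex.continuous_ofReal.comp (WeakDual.eval_continuous _)).add
      ((Complex.continuous_ofReal.comp (WeakDual.eval_continuous _)).mul continuous_const)
  have key : ∀ (φ : WeakDual ℝ (Lp ℝ 1 μ)) (h : X → ℝ) (hm : Measurable h)
      (h01 : ∀ x, h x ∈ Set.Icc (0 : ℝ) 1), WeakDual.toStrongDual φ =
        boundedPairing μ hm (fun x => abs_le_one_of_mem_Icc (h01 x)) →
      ∀ k, F φ k = ∫ x, (h x : ℂ) * d k x ∂μ := fun φ h hm h01 hφ k => by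
    have hi : Integrable (fun x => (h x : ℂ) * d k x) μ :=
      (hd k).bdd_mul (Complex.measurable_ofReal.comp hm).aestronglyMeasurable (c := 1)
        (ae_of_all _ fun x => by
          rw [Complex.norm_real]; exact abs_le_one_of_mem_Icc (h01 x))
    have e1 : ∀ f, φ f = boundedPairing μ hm (fun x => abs_le_one_of_mem_Icc (h01 x)) f :=
      fun f => DFunLike.congr_fun hφ f
    change ((φ ((hd k).re.toL1 _) : ℝ) : ℂ) + ((φ ((hd k).im.toL1 _) : ℝ) : ℂ) * Complex.I = _
    rw [e1, e1, boundedPairing_toLp, boundedPairing_toLp, ← integral_re_add_im hi]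
    simp
  convert isCompact_unitIntervalDual.image hF using 1
  ext c
  constructor
  · rintro ⟨h, hm, h01, hc⟩
    refine ⟨WeakDual.toStrongDual.symm
      (boundedPairing μ hm fun x => abs_le_one_of_mem_Icc (h01 x)), ⟨h, hm, h01, by simp⟩, ?_⟩
    funext k
    rw [hc, key _ h hm h01 (by simp)]
  · rintro ⟨φ, ⟨h, hm, h01, hφ⟩, rfl⟩
    exact ⟨h, hm, h01, key φ h hm h01 hφ⟩

/-- If integration of the family `d` is nowhere injective, then the integrals of `d` against a
function with values in `[0, 1]` agree with the integrals over some measurable set: an extreme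
point of the set of functions with the given integrals is an indicator function. -/
theorem exists_setIntegral_eq [IsFiniteMeasure μ] {κ : Type*} {d : κ → X → ℝ}
    (hd : ∀ k, Integrable (d k) μ)
    (hn : ∀ E, MeasurableSet E → μ E ≠ 0 → ∃ u : X → ℝ, Measurable u ∧ (∃ M, ∀ x, |u x| ≤ M) ∧
      (∀ x, x ∉ E → u x = 0) ∧ ¬ u =ᵐ[μ] 0 ∧ ∀ k, ∫ x, u x * d k x ∂μ = 0)
    {h : X → ℝ} (hm : Measurable h) (h01 : ∀ x, h x ∈ Set.Icc (0 : ℝ) 1) :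
    ∃ E, MeasurableSet E ∧ ∀ k, ∫ x in E, d k x ∂μ = ∫ x, h x * d k x ∂μ := by
  -- The fibre of functions having the same integrals as `h`.
  let S : Set (WeakDual ℝ (Lp ℝ 1 μ)) := unitIntervalDual μ ∩
    {φ | ∀ k, φ ((hd k).toL1 _) = ∫ x, h x * d k x ∂μ}
  have hSc : IsCompact S := by
    refine isCompact_unitIntervalDual.inter_right ?_
    rw [Set.ofPred_forall]
    exact isClosed_iInter fun k => isClosed_eq (WeakDual.eval_continuous _) continuous_const
  have hSn : S.Nonempty := by
    refine ⟨WeakDual.toStrongDual.symm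
      (boundedPairing μ hm fun x => abs_le_one_of_mem_Icc (h01 x)), ⟨h, hm, h01, by simp⟩,
      fun k => ?_⟩
    exact boundedPairing_toLp hm (fun x => abs_le_one_of_mem_Icc (h01 x)) (hd k)
  have : LocallyConvexSpace ℝ (WeakDual ℝ (Lp ℝ 1 μ)) :=
    (LinearMap.weakBilin_withSeminorms (topDualPairing ℝ (Lp ℝ 1 μ))).toLocallyConvexSpace
  obtain ⟨φ, ⟨⟨g, gm, g01, hφ⟩, hφk⟩, hext⟩ := hSc.extremePoints_nonempty hSn
  have hgk : ∀ k, ∫ x, g x * d k x ∂μ = ∫ x, h x * d k x ∂μ := fun k => by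
    rw [← hφk k, ← boundedPairing_toLp gm (fun x => abs_le_one_of_mem_Icc (g01 x)) (hd k), ← hφ]
    rfl
  -- Where `ε ≤ g ≤ 1 - ε` there is room to move `g` by `ε` both ways within `[0,1]`.
  have hmid : ∀ ε : ℝ, 0 < ε → μ {x | ε ≤ g x ∧ g x ≤ 1 - ε} = 0 := fun ε hε => by
    by_contra hne
    obtain ⟨u, um, ⟨M, hM⟩, u0, une, uk⟩ := hn _
      ((measurableSet_le measurable_const gm).inter (measurableSet_le gm measurable_const)) hne
    have hM1 : 0 < |M| + 1 := by positivity
    let v : X → ℝ := fun x => ε / (|M| + 1) * u x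
    have vm : Measurable v := um.const_mul _
    have hv : ∀ x, |v x| ≤ ε := fun x => by
      change |ε / (|M| + 1) * u x| ≤ ε
      rw [abs_mul, abs_of_pos (div_pos hε hM1), div_mul_eq_mul_div, div_le_iff₀ hM1]
      exact mul_le_mul_of_nonneg_left ((hM x).trans (by linarith [le_abs_self M])) hε.le
    have hmem : ∀ (w : X → ℝ) (wm : Measurable w) (hw : ∀ x, |w x| ≤ ε)
        (w0 : ∀ x, ¬ (ε ≤ g x ∧ g x ≤ 1 - ε) → w x = 0) (wk : ∀ k, ∫ x, w x * d k x ∂μ = 0),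
        φ + WeakDual.toStrongDual.symm (boundedPairing μ wm hw) ∈ S :=
      fun w wm hw w0 wk => by
        refine ⟨⟨fun x => g x + w x, gm.add wm, fun x => ?_, ?_⟩, fun k => ?_⟩
        · by_cases hx : ε ≤ g x ∧ g x ≤ 1 - ε
          · have := abs_le.1 (hw x)
            exact ⟨by linarith, by linarith⟩
          · simpa [w0 x hx] using g01 x
        · rw [map_add, hφ, LinearEquiv.apply_symm_apply]
          ext f
          rw [add_apply, boundedPairing_apply, boundedPairing_apply,
            boundedPairing_apply, ← integral_add
              (integrable_bdd_mul gm (fun x => abs_le_one_of_mem_Icc (g01 x))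
                (L1.integrable_coeFn f))
              (integrable_bdd_mul wm hw (L1.integrable_coeFn f))]
          simp only [add_mul]
        · change φ _ + boundedPairing μ wm hw _ = _
          rw [hφk, boundedPairing_toLp, wk, add_zero]
    have vk : ∀ k, ∫ x, v x * d k x ∂μ = 0 := fun k => by
      simp only [v, mul_assoc]
      rw [integral_const_mul, uk, mul_zero]
    have v0 : ∀ x, ¬ (ε ≤ g x ∧ g x ≤ 1 - ε) → v x = 0 := fun x hx => by
      simp only [v]
      rw [u0 x hx, mul_zero]
    have h1 := hmem v vm hv v0 vk
    have h2 := hmem (fun x => - v x) vm.neg (fun x => by rw [abs_neg]; exact hv x)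
      (fun x hx => by rw [v0 x hx, neg_zero])
      (fun k => by simp only [neg_mul]; rw [integral_neg, vk, neg_zero])
    have hneg : boundedPairing μ vm.neg (fun x => by rw [Pi.neg_apply, abs_neg]; exact hv x)
        = - boundedPairing μ vm hv := by
      ext f
      rw [neg_apply, boundedPairing_apply, boundedPairing_apply,
        ← integral_neg]
      simp
    -- `φ` is the midpoint of its translates by `v` and `-v`, so extremality makes `v` vanish as a
    -- functional.
    have h3 := hext h1 h2 ⟨1 / 2, 1 / 2, by norm_num, by norm_num, by norm_num, by
      have : WeakDual.toStrongDual.symm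
          (boundedPairing μ vm.neg fun x => by rw [Pi.neg_apply, abs_neg]; exact hv x)
          = - WeakDual.toStrongDual.symm (boundedPairing μ vm hv) := by rw [hneg, map_neg]
      erw [this]
      module⟩
    have h4 : boundedPairing μ vm hv = 0 := by
      rwa [add_eq_left, LinearEquiv.map_eq_zero_iff] at h3
    have hvi : Integrable v μ := by
      simpa using integrable_bdd_mul vm hv (integrable_const (1 : ℝ))
    -- Being bounded on a finite measure space, `v` is itself in `L¹`; pairing it with itself gives
    -- `∫ v² = 0`.
    have h5 : ∫ x, v x * v x ∂μ = 0 := by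
      rw [← boundedPairing_toLp vm hv hvi, h4, zero_apply]
    rw [integral_eq_zero_iff_of_nonneg (fun x => mul_self_nonneg _)
      (integrable_bdd_mul vm hv hvi)] at h5
    refine une ?_
    filter_upwards [h5] with x hx
    have := mul_self_eq_zero.1 hx
    exact (mul_eq_zero.1 this).resolve_left (div_pos hε hM1).ne'
  have hae : ∀ᵐ x ∂μ, g x = 0 ∨ g x = 1 := by
    have : ∀ᵐ x ∂μ, ∀ n : ℕ, ¬ (1 / ((n : ℝ) + 1) ≤ g x ∧ g x ≤ 1 - 1 / ((n : ℝ) + 1)) :=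
      ae_all_iff.2 fun n => by
        rw [ae_iff]
        simpa only [not_not] using hmid (1 / ((n : ℝ) + 1)) (by positivity)
    filter_upwards [this] with x hx
    by_contra! hne
    have hp : 0 < min (g x) (1 - g x) :=
      lt_min (lt_of_le_of_ne (g01 x).1 hne.1.symm) (sub_pos.2 (lt_of_le_of_ne (g01 x).2 hne.2))
    obtain ⟨n, hn⟩ := exists_nat_one_div_lt hp
    exact hx n ⟨hn.le.trans (min_le_left _ _), by linarith [min_le_right (g x) (1 - g x)]⟩
  have hE : MeasurableSet {x | g x = 1} := gm (measurableSet_singleton 1)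
  refine ⟨_, hE, fun k => ?_⟩
  rw [← hgk, ← integral_indicator hE]
  refine integral_congr_ae ?_
  filter_upwards [hae] with x hx
  rcases hx with hx | hx <;> simp [hx]

end UnitInterval

namespace OperatorMeasure

set_option linter.unusedSectionVars false

/-! ### Positive operators, separation by states, and null sets of the scalar measure -/

section Operators

variable {ι H X : Type*} [NormedAddCommGroup H] [InnerProductSpace ℂ H] [CompleteSpace H]

theorem inner_self_nonneg_of_nonneg {A : H →L[ℂ] H} (hA : 0 ≤ A) (v : H) : 0 ≤ ⟪v, A v⟫_ℂ :=
  ((ContinuousLinearMap.nonneg_iff_isPositive A).1 hA).inner_nonneg_right v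

theorem nonneg_of_inner_self_nonneg {A : H →L[ℂ] H} (hA : ∀ v, 0 ≤ ⟪v, A v⟫_ℂ) : 0 ≤ A := by
  rw [ContinuousLinearMap.nonneg_iff_isPositive, ContinuousLinearMap.isPositive_iff_complex]
  intro v
  have h := Complex.nonneg_iff.1 (hA v)
  have h2 : ⟪A v, v⟫_ℂ = ((⟪v, A v⟫_ℂ).re : ℂ) := by
    rw [← inner_conj_symm (A v) v]
    exact Complex.ext (by rw [Complex.conj_re, Complex.ofReal_re])
      (by rw [Complex.conj_im, Complex.ofReal_im, ← h.2, neg_zero])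
  rw [h2]
  exact ⟨by simp, by simpa only [RCLike.re_to_complex, Complex.ofReal_re] using h.1⟩

theorem isSelfAdjoint_sqrt (A : H →L[ℂ] H) : IsSelfAdjoint (CFC.sqrt A) :=
  (CFC.sqrt_nonneg A).isSelfAdjoint

theorem inner_sqrt_left (A : H →L[ℂ] H) (v w : H) :
    ⟪CFC.sqrt A v, w⟫_ℂ = ⟪v, CFC.sqrt A w⟫_ℂ := by
  conv_lhs => rw [← (isSelfAdjoint_sqrt A).adjoint_eq]
  exact ContinuousLinearMap.adjoint_inner_left _ _ _

theorem inner_eq_inner_sqrt {A : H →L[ℂ] H} (hA : 0 ≤ A) (v w : H) :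
    ⟪v, A w⟫_ℂ = ⟪CFC.sqrt A v, CFC.sqrt A w⟫_ℂ := by
  rw [inner_sqrt_left, ← mul_apply_eq_comp, CFC.sqrt_mul_sqrt_self A hA]

theorem norm_sqrt_sq {A : H →L[ℂ] H} (hA : 0 ≤ A) (v : H) :
    ‖CFC.sqrt A v‖ ^ 2 = ‖⟪v, A v⟫_ℂ‖ := by
  rw [inner_eq_inner_sqrt hA, inner_self_eq_norm_sq_to_K]
  simp

/-- Cauchy–Schwarz for the form of `A`, followed by the arithmetic-geometric mean inequality: a sum
of diagonal terms is integrable as soon as each term is. -/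
theorem norm_inner_le_of_nonneg {A : H →L[ℂ] H} (hA : 0 ≤ A) (v w : H) :
    ‖⟪v, A w⟫_ℂ‖ ≤ (‖⟪v, A v⟫_ℂ‖ + ‖⟪w, A w⟫_ℂ‖) / 2 := by
  rw [← norm_sqrt_sq hA, ← norm_sqrt_sq hA, inner_eq_inner_sqrt hA]
  refine (norm_inner_le_norm _ _).trans ?_
  nlinarith [sq_nonneg (‖CFC.sqrt A v‖ - ‖CFC.sqrt A w‖)]

theorem ext_of_inner_basis (e : HilbertBasis ι ℂ H) {A B : H →L[ℂ] H}
    (h : ∀ i j, ⟪e i, A (e j)⟫_ℂ = ⟪e i, B (e j)⟫_ℂ) : A = B := by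
  have hd := Submodule.dense_iff_topologicalClosure_eq_top.2 e.dense_span
  refine ContinuousLinearMap.ext_on hd ?_
  rintro _ ⟨j, rfl⟩
  refine hd.eq_of_inner_right (𝕜 := ℂ) fun v hv => ?_
  induction hv using Submodule.span_induction with
  | mem v h' => obtain ⟨i, rfl⟩ := h'; exact h i j
  | zero => simp
  | add v w _ _ hv hw => simp only [inner_add_left] at *; rw [hv, hw]
  | smul c v _ hv => simp only [inner_smul_left] at *; rw [hv]

theorem countable_of_hilbertBasis [TopologicalSpace.SeparableSpace H] (e : HilbertBasis ι ℂ H) :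
    Countable ι := by
  have h : (Set.univ : Set ι).PairwiseDisjoint fun i => Metric.ball (e i) (1 / 2) := by
    intro i _ j _ hij
    refine Metric.ball_disjoint_ball ?_
    have h2 : ‖e i - e j‖ ^ 2 = 2 := by
      rw [norm_sub_sq (𝕜 := ℂ), e.orthonormal.1, e.orthonormal.1, e.orthonormal.2 hij]
      norm_num
    rw [dist_eq_norm]
    nlinarith [norm_nonneg (e i - e j)]
  rw [← Set.countable_univ_iff]
  exact h.countable_of_isOpen (fun _ _ => Metric.isOpen_ball)
    fun i _ => Metric.nonempty_ball.2 (by norm_num)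

/-- The rank one projection onto a unit vector, as a state. -/
noncomputable def pureState (e : HilbertBasis ι ℂ H) (v : H) (hv : ‖v‖ = 1) : State e where
  op := InnerProductSpace.rankOne ℂ v v
  nonneg := (ContinuousLinearMap.nonneg_iff_isPositive _).2
    (InnerProductSpace.isPositive_rankOne_self v)
  hasSum_one := by
    have h := e.hasSum_inner_mul_inner v v
    rw [inner_self_eq_norm_sq_to_K, hv] at h
    simpa [inner_smul_right] using h

theorem trace_pureState_mul (e : HilbertBasis ι ℂ H) {v : H} (hv : ‖v‖ = 1) (A : H →L[ℂ] H) :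
    trace e ((pureState e v hv).op * A) = ⟪v, A v⟫_ℂ := by
  have h := e.hasSum_inner_mul_inner (ContinuousLinearMap.adjoint A v) v
  rw [ContinuousLinearMap.adjoint_inner_left] at h
  rw [trace, ← h.tsum_eq]
  refine tsum_congr fun i => ?_
  rw [mul_apply_eq_comp, ContinuousLinearMap.adjoint_inner_left]
  exact inner_smul_right _ _ _

/-- States separate the bounded operators. -/
theorem eq_of_trace_state_mul_eq (e : HilbertBasis ι ℂ H) {A B : H →L[ℂ] H}
    (h : ∀ s : State e, trace e (s.op * A) = trace e (s.op * B)) : A = B := by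
  have h1 : ∀ v, ⟪v, A v⟫_ℂ = ⟪v, B v⟫_ℂ := fun v => by
    by_cases hv : v = 0
    · simp [hv]
    have hn : ‖((‖v‖⁻¹ : ℝ) : ℂ) • v‖ = 1 := by
      rw [norm_smul, Complex.norm_real, norm_inv, norm_norm,
        inv_mul_cancel₀ (norm_ne_zero_iff.2 hv)]
    have h2 := h (pureState e _ hn)
    rw [trace_pureState_mul, trace_pureState_mul] at h2
    simp only [map_smul, inner_smul_left, inner_smul_right] at h2
    have h3 : ((‖v‖⁻¹ : ℝ) : ℂ) ≠ 0 := by simpa using hv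
    have h4 : (starRingEnd ℂ) ((‖v‖⁻¹ : ℝ) : ℂ) ≠ 0 := by simpa using hv
    exact mul_left_cancel₀ h4 (mul_left_cancel₀ h3 h2)
  -- Pure states give equal quadratic forms; complex polarization gives equal operators.
  refine ContinuousLinearMap.coe_injective ((ext_inner_map _ _).1 fun v => ?_)
  change ⟪A v, v⟫_ℂ = ⟪B v, v⟫_ℂ
  rw [← inner_conj_symm, ← inner_conj_symm (B v) v, h1]

theorem trace_add_mul (e : HilbertBasis ι ℂ H) {S T : H →L[ℂ] H} (hS : S ∈ traceClass e)
    (hT : T ∈ traceClass e) (A : H →L[ℂ] H) :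
    trace e ((S + T) * A) = trace e (S * A) + trace e (T * A) := by
  simp only [trace]
  rw [← (summable_trace e hS A).tsum_add (summable_trace e hT A)]
  exact tsum_congr fun i => by rw [add_mul, add_apply, inner_add_right]

theorem trace_smul_mul (e : HilbertBasis ι ℂ H) (c : ℂ) (T A : H →L[ℂ] H) :
    trace e ((c • T) * A) = c * trace e (T * A) := by
  simp only [trace]
  rw [← tsum_mul_left]
  exact tsum_congr fun i => by rw [smul_mul_assoc, smul_apply, inner_smul_right]

theorem trace_mul_add (e : HilbertBasis ι ℂ H) {T : H →L[ℂ] H} (hT : T ∈ traceClass e)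
    (A B : H →L[ℂ] H) : trace e (T * (A + B)) = trace e (T * A) + trace e (T * B) := by
  simp only [trace]
  rw [← (summable_trace e hT A).tsum_add (summable_trace e hT B)]
  exact tsum_congr fun i => by rw [mul_add, add_apply, inner_add_right]

theorem trace_mul_smul (e : HilbertBasis ι ℂ H) (c : ℂ) (T A : H →L[ℂ] H) :
    trace e (T * (c • A)) = c * trace e (T * A) := by
  rw [mul_smul_comm, ← smul_mul_assoc, trace_smul_mul]

variable [MeasurableSpace X] {e : HilbertBasis ι ℂ H}

namespace POVM

variable (ν : POVM X e)

instance isFiniteMeasure_scalar (ρ : State e) : IsFiniteMeasure (ν.scalar ρ) :=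
  ⟨by rw [scalar, Measure.ofMeasurable_apply _ MeasurableSet.univ]; exact ENNReal.ofReal_lt_top⟩

/-- The scalar measure of a full rank state has the same null sets as `ν`. -/
theorem scalar_eq_zero_iff {ρ : State e} (hρ : ρ.FullRank) {E : Set X} (hE : MeasurableSet E) :
    ν.scalar ρ E = 0 ↔ ν E = 0 := by
  have h1 : ν.scalar ρ E = 0 ↔ trace e (ρ.op * ν E) = 0 := by
    rw [← ν.scalar_apply ρ hE, Complex.ofReal_eq_zero, measureReal_eq_zero_iff]
  rw [h1]
  constructor
  · intro h
    -- The trace equals that of `ρ^{1/2} ν(E) ρ^{1/2}`, a sum of nonnegative terms, so all of them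
    -- vanish and `ν(E)^{1/2} ρ^{1/2} = 0`. Taking adjoints gives `ρ ν(E)^{1/2} = 0`, and `ρ` is
    -- injective.
    obtain ⟨t, ht1, ht2⟩ := exists_hasSum_pos e ρ.nonneg ρ.hasSum_one.summable (ν E)
    have ht : t = 0 := ht1.tsum_eq.symm.trans h
    rw [ht] at ht2
    have h2 : ∀ j, ⟪CFC.sqrt ρ.op (e j), ν E (CFC.sqrt ρ.op (e j))⟫_ℂ = 0 := fun j =>
      congrFun ((hasSum_zero_iff_of_nonneg fun j =>
        inner_self_nonneg_of_nonneg (ν.nonneg E hE) _).1 ht2) j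
    have h3 : ∀ j, CFC.sqrt (ν E) (CFC.sqrt ρ.op (e j)) = 0 := fun j => by
      rw [← norm_eq_zero, ← sq_eq_zero_iff, norm_sqrt_sq (ν.nonneg E hE), h2, norm_zero]
    have h4 : CFC.sqrt (ν E) * CFC.sqrt ρ.op = 0 :=
      ext_of_inner_basis e fun i j => by rw [mul_apply_eq_comp, h3]; simp
    have h5 : ρ.op * CFC.sqrt (ν E) = 0 := by
      have h6 := congrArg star h4
      rw [star_mul, (isSelfAdjoint_sqrt _).star_eq, (isSelfAdjoint_sqrt _).star_eq,
        star_zero] at h6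
      rw [← CFC.sqrt_mul_sqrt_self ρ.op ρ.nonneg, mul_assoc, h6, mul_zero]
    have h6 : CFC.sqrt (ν E) = 0 := by
      ext v
      refine hρ ?_
      rw [← mul_apply_eq_comp, h5]
      simp
    rw [← CFC.sqrt_mul_sqrt_self (ν E) (ν.nonneg E hE), h6, mul_zero]
  · intro h
    simp [h, trace]

end POVM

end Operators

/-! ### Sesquilinear integrals of the Radon–Nikodým derivative -/

namespace IsRNDeriv

variable {ι H X : Type*} [NormedAddCommGroup H] [InnerProductSpace ℂ H] [CompleteSpace H]
  [MeasurableSpace X] {e : HilbertBasis ι ℂ H} {ν : POVM X e} {ρ : State e} {D : X → (H →L[ℂ] H)}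

theorem integrable_and_setIntegral_of_mem_span (hD : IsRNDeriv ν ρ D) {v w : H}
    (hv : v ∈ Submodule.span ℂ (Set.range e)) (hw : w ∈ Submodule.span ℂ (Set.range e)) :
    Integrable (fun x => ⟪v, D x w⟫_ℂ) (ν.scalar ρ) ∧
      ∀ E, MeasurableSet E → ⟪v, ν E w⟫_ℂ = ∫ x in E, ⟪v, D x w⟫_ℂ ∂(ν.scalar ρ) := by
  induction hv, hw using Submodule.span_induction₂ with
  | mem_mem v w hv hw =>
    obtain ⟨i, rfl⟩ := hv
    obtain ⟨j, rfl⟩ := hw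
    exact ⟨hD.integrable i j, hD.setIntegral_eq i j⟩
  | zero_left w hw => simp
  | zero_right v hv => simp
  | add_left v v' w _ _ _ h h' =>
    simp only [inner_add_left]
    exact ⟨h.1.add h'.1, fun E hE => by
      rw [integral_add h.1.integrableOn h'.1.integrableOn, h.2 E hE, h'.2 E hE]⟩
  | add_right v w w' _ _ _ h h' =>
    simp only [map_add, inner_add_right]
    exact ⟨h.1.add h'.1, fun E hE => by
      rw [integral_add h.1.integrableOn h'.1.integrableOn, h.2 E hE, h'.2 E hE]⟩
  | smul_left c v w _ _ h =>
    simp only [inner_smul_left]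
    exact ⟨h.1.const_mul _, fun E hE => by rw [integral_const_mul, h.2 E hE]⟩
  | smul_right c v w _ _ h =>
    simp only [map_smul, inner_smul_right]
    exact ⟨h.1.const_mul _, fun E hE => by rw [integral_const_mul, h.2 E hE]⟩

theorem ae_inner_nonneg_of_mem_span (hD : IsRNDeriv ν ρ D) {v : H}
    (hv : v ∈ Submodule.span ℂ (Set.range e)) :
    ∀ᵐ x ∂(ν.scalar ρ), 0 ≤ ⟪v, D x v⟫_ℂ := by
  obtain ⟨hi, hE⟩ := hD.integrable_and_setIntegral_of_mem_span hv hv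
  have hn : ∀ E, MeasurableSet E → 0 ≤ ∫ x in E, ⟪v, D x v⟫_ℂ ∂(ν.scalar ρ) := fun E hm => by
    rw [← hE E hm]
    exact inner_self_nonneg_of_nonneg (ν.nonneg E hm) v
  have hre := ae_nonneg_of_forall_setIntegral_nonneg hi.re fun E hm _ => by
    have h := (Complex.nonneg_iff.1 (hn E hm)).1
    rwa [← RCLike.re_to_complex, ← integral_re hi.integrableOn] at h
  have him := ae_eq_zero_of_forall_setIntegral_eq_of_sigmaFinite
    (fun E _ _ => hi.im.integrableOn) fun E hm _ => by
    have h := (Complex.nonneg_iff.1 (hn E hm)).2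
    rw [← RCLike.im_to_complex, ← integral_im hi.integrableOn] at h
    exact h.symm
  filter_upwards [hre, him] with x h1 h2
  exact Complex.nonneg_iff.2 ⟨h1, h2.symm⟩

/-- The exceptional null set depends on the vector, so a countable dense subset of the span is used;
boundedness of each `D x` carries the inequality to every vector. -/
theorem ae_nonneg [TopologicalSpace.SeparableSpace H] (hD : IsRNDeriv ν ρ D) :
    ∀ᵐ x ∂(ν.scalar ρ), 0 ≤ D x := by
  obtain ⟨c, hcs, hcc, hcd⟩ := (TopologicalSpace.IsSeparable.of_separableSpace
    (Submodule.span ℂ (Set.range e) : Set H)).exists_countable_dense_subset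
  have hd : Dense c := dense_closure.1
    ((Submodule.dense_iff_topologicalClosure_eq_top.2 e.dense_span).mono hcd)
  have h : ∀ᵐ x ∂(ν.scalar ρ), ∀ v ∈ c, 0 ≤ ⟪v, D x v⟫_ℂ :=
    (ae_ball_iff hcc).2 fun v hv => hD.ae_inner_nonneg_of_mem_span (hcs hv)
  filter_upwards [h] with x hx
  refine nonneg_of_inner_self_nonneg fun v => ?_
  have hcl : IsClosed {v : H | 0 ≤ ⟪v, D x v⟫_ℂ} :=
    isClosed_le continuous_const (continuous_id.inner (D x).continuous)
  exact hcl.closure_subset_iff.2 hx (hd v)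

theorem exists_seq_mem_span (e : HilbertBasis ι ℂ H) (v : H) :
    ∃ u : ℕ → H, (∀ n, u n ∈ Submodule.span ℂ (Set.range e)) ∧ Tendsto u atTop (𝓝 v) :=
  mem_closure_iff_seq_limit.1 (Submodule.dense_iff_topologicalClosure_eq_top.2 e.dense_span v)

theorem aestronglyMeasurable_inner (hD : IsRNDeriv ν ρ D) (v w : H) :
    AEStronglyMeasurable (fun x => ⟪v, D x w⟫_ℂ) (ν.scalar ρ) := by
  obtain ⟨a, ha, hav⟩ := exists_seq_mem_span e v
  obtain ⟨b, hb, hbw⟩ := exists_seq_mem_span e w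
  refine aestronglyMeasurable_of_tendsto_ae atTop
    (fun n => (hD.integrable_and_setIntegral_of_mem_span (ha n) (hb n)).1.aestronglyMeasurable)
    (ae_of_all _ fun x => ?_)
  exact hav.inner (((D x).continuous.tendsto w).comp hbw)

/-- On the span the integrand is nonnegative almost everywhere and its integral is `⟨a, ν(X) a⟩`.
Fatou's lemma passes the bound to limits of such vectors. -/
theorem lintegral_enorm_inner_self_le [TopologicalSpace.SeparableSpace H]
    (hD : IsRNDeriv ν ρ D) (v : H) :
    ∫⁻ x, ‖⟪v, D x v⟫_ℂ‖ₑ ∂(ν.scalar ρ) ≤ ENNReal.ofReal (‖ν Set.univ‖ * ‖v‖ ^ 2) := by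
  obtain ⟨a, ha, hav⟩ := exists_seq_mem_span e v
  have h1 : ∀ n, ∫⁻ x, ‖⟪a n, D x (a n)⟫_ℂ‖ₑ ∂(ν.scalar ρ)
      ≤ ENNReal.ofReal (‖ν Set.univ‖ * ‖a n‖ ^ 2) := fun n => by
    obtain ⟨hi, hE⟩ := hD.integrable_and_setIntegral_of_mem_span (ha n) (ha n)
    rw [← ofReal_integral_norm_eq_lintegral_enorm hi]
    refine ENNReal.ofReal_le_ofReal ?_
    have h2 : ∫ x, ‖⟪a n, D x (a n)⟫_ℂ‖ ∂(ν.scalar ρ) = (⟪a n, ν Set.univ (a n)⟫_ℂ).re := by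
      rw [hE _ MeasurableSet.univ, Measure.restrict_univ, ← RCLike.re_to_complex,
        ← integral_re hi]
      refine integral_congr_ae ?_
      filter_upwards [hD.ae_inner_nonneg_of_mem_span (ha n)] with x hx
      rw [RCLike.re_to_complex]
      simpa only [Complex.ofReal_re] using congrArg Complex.re (Complex.norm_of_nonneg' hx)
    rw [h2, sq, ← mul_assoc, mul_comm]
    refine (Complex.re_le_norm _).trans ((norm_inner_le_norm _ _).trans ?_)
    exact mul_le_mul_of_nonneg_left ((ν Set.univ).le_opNorm _) (norm_nonneg _)
  have h2 : ∀ x, Tendsto (fun n => ‖⟪a n, D x (a n)⟫_ℂ‖ₑ) atTop (𝓝 ‖⟪v, D x v⟫_ℂ‖ₑ) :=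
    fun x => (hav.inner (((D x).continuous.tendsto v).comp hav)).enorm
  calc ∫⁻ x, ‖⟪v, D x v⟫_ℂ‖ₑ ∂(ν.scalar ρ)
      = ∫⁻ x, liminf (fun n => ‖⟪a n, D x (a n)⟫_ℂ‖ₑ) atTop ∂(ν.scalar ρ) :=
        lintegral_congr fun x => (h2 x).liminf_eq.symm
    _ ≤ liminf (fun n => ∫⁻ x, ‖⟪a n, D x (a n)⟫_ℂ‖ₑ ∂(ν.scalar ρ)) atTop :=
        lintegral_liminf_le' fun n => (hD.aestronglyMeasurable_inner _ _).enorm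
    _ ≤ liminf (fun n => ENNReal.ofReal (‖ν Set.univ‖ * ‖a n‖ ^ 2)) atTop :=
        liminf_le_liminf (Eventually.of_forall h1)
    _ = ENNReal.ofReal (‖ν Set.univ‖ * ‖v‖ ^ 2) :=
        (ENNReal.tendsto_ofReal ((hav.norm.pow 2).const_mul _)).liminf_eq

theorem integrable_inner_self [TopologicalSpace.SeparableSpace H] (hD : IsRNDeriv ν ρ D) (v : H) :
    Integrable (fun x => ⟪v, D x v⟫_ℂ) (ν.scalar ρ) :=
  ⟨hD.aestronglyMeasurable_inner v v,
    (hD.lintegral_enorm_inner_self_le v).trans_lt ENNReal.ofReal_lt_top⟩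

theorem integral_norm_inner_self_le [TopologicalSpace.SeparableSpace H] (hD : IsRNDeriv ν ρ D)
    (v : H) : ∫ x, ‖⟪v, D x v⟫_ℂ‖ ∂(ν.scalar ρ) ≤ ‖ν Set.univ‖ * ‖v‖ ^ 2 := by
  rw [integral_norm_eq_lintegral_enorm (hD.aestronglyMeasurable_inner v v)]
  exact ENNReal.toReal_le_of_le_ofReal (by positivity) (hD.lintegral_enorm_inner_self_le v)

theorem integrable_inner [TopologicalSpace.SeparableSpace H] (hD : IsRNDeriv ν ρ D) (v w : H) :
    Integrable (fun x => ⟪v, D x w⟫_ℂ) (ν.scalar ρ) := by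
  refine (((hD.integrable_inner_self v).norm.add (hD.integrable_inner_self w).norm).div_const
    2).mono' (hD.aestronglyMeasurable_inner v w) ?_
  filter_upwards [hD.ae_nonneg] with x hx
  exact norm_inner_le_of_nonneg hx v w

theorem integral_norm_inner_le [TopologicalSpace.SeparableSpace H] (hD : IsRNDeriv ν ρ D)
    (v w : H) : ∫ x, ‖⟪v, D x w⟫_ℂ‖ ∂(ν.scalar ρ) ≤ ‖ν Set.univ‖ * ‖v‖ * ‖w‖ := by
  have h1 : ∀ v w : H, ∫ x, ‖⟪v, D x w⟫_ℂ‖ ∂(ν.scalar ρ)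
      ≤ ‖ν Set.univ‖ * (‖v‖ ^ 2 + ‖w‖ ^ 2) / 2 := fun v w => by
    have h2 : ∫ x, ‖⟪v, D x w⟫_ℂ‖ ∂(ν.scalar ρ)
        ≤ ∫ x, (‖⟪v, D x v⟫_ℂ‖ + ‖⟪w, D x w⟫_ℂ‖) / 2 ∂(ν.scalar ρ) := by
      refine integral_mono_ae (hD.integrable_inner v w).norm
        (((hD.integrable_inner_self v).norm.add (hD.integrable_inner_self w).norm).div_const 2) ?_
      filter_upwards [hD.ae_nonneg] with x hx
      exact norm_inner_le_of_nonneg hx v w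
    rw [integral_div, integral_add (hD.integrable_inner_self v).norm
      (hD.integrable_inner_self w).norm] at h2
    linarith [hD.integral_norm_inner_self_le v, hD.integral_norm_inner_self_le w]
  by_cases hv : v = 0
  · simp [hv]
  by_cases hw : w = 0
  · simp [hw]
  have hv' := norm_pos_iff.2 hv
  have hw' := norm_pos_iff.2 hw
  -- Normalizing both vectors turns the bound by a sum of squares into one by the product of norms,
  -- as a bounded sesquilinear form requires.
  have h3 := h1 (((‖v‖⁻¹ : ℝ) : ℂ) • v) (((‖w‖⁻¹ : ℝ) : ℂ) • w)
  have h4 : ∀ x, ‖⟪((‖v‖⁻¹ : ℝ) : ℂ) • v, D x (((‖w‖⁻¹ : ℝ) : ℂ) • w)⟫_ℂ‖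
      = ‖v‖⁻¹ * ‖w‖⁻¹ * ‖⟪v, D x w⟫_ℂ‖ := fun x => by
    rw [map_smul, inner_smul_left, inner_smul_right, Complex.conj_ofReal, norm_mul, norm_mul,
      Complex.norm_real, Complex.norm_real, norm_inv, norm_norm, norm_inv, norm_norm, mul_assoc]
  have h5 : ∀ u : H, 0 < ‖u‖ → ‖((‖u‖⁻¹ : ℝ) : ℂ) • u‖ = 1 := fun u hu => by
    rw [norm_smul, Complex.norm_real, norm_inv, norm_norm, inv_mul_cancel₀ hu.ne']
  simp only [h4] at h3
  rw [integral_const_mul, h5 v hv', h5 w hw'] at h3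
  have h6 := mul_le_mul_of_nonneg_left h3 (mul_pos hv' hw').le
  calc ∫ x, ‖⟪v, D x w⟫_ℂ‖ ∂(ν.scalar ρ)
      = ‖v‖ * ‖w‖ * (‖v‖⁻¹ * ‖w‖⁻¹ * ∫ x, ‖⟪v, D x w⟫_ℂ‖ ∂(ν.scalar ρ)) := by field_simp
    _ ≤ _ := h6
    _ = ‖ν Set.univ‖ * ‖v‖ * ‖w‖ := by ring

theorem integrable_mul_inner [TopologicalSpace.SeparableSpace H] (hD : IsRNDeriv ν ρ D)
    {h : X → ℂ} (hm : Measurable h) {M : ℝ} (hM : ∀ x, ‖h x‖ ≤ M) (v w : H) :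
    Integrable (fun x => h x * ⟪v, D x w⟫_ℂ) (ν.scalar ρ) :=
  (hD.integrable_inner v w).bdd_mul hm.aestronglyMeasurable (ae_of_all _ hM)

/-- The integral of a bounded scalar function against `D`, in the weak sense. -/
theorem exists_inner_eq_integral [TopologicalSpace.SeparableSpace H] (hD : IsRNDeriv ν ρ D)
    {h : X → ℂ} (hm : Measurable h) {M : ℝ} (hM : ∀ x, ‖h x‖ ≤ M) :
    ∃ A : H →L[ℂ] H, ∀ v w, ⟪v, A w⟫_ℂ = ∫ x, h x * ⟪v, D x w⟫_ℂ ∂(ν.scalar ρ) := by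
  have hi := hD.integrable_mul_inner hm hM
  let B : H →ₗ⋆[ℂ] H →ₗ[ℂ] ℂ := LinearMap.mk₂'ₛₗ (starRingEnd ℂ) (RingHom.id ℂ)
    (fun v w => ∫ x, h x * ⟪v, D x w⟫_ℂ ∂(ν.scalar ρ))
    (fun v v' w => by
      rw [← integral_add (hi v w) (hi v' w)]
      simp only [inner_add_left, mul_add])
    (fun c v w => by
      rw [smul_eq_mul, ← integral_const_mul]
      simp only [inner_smul_left, mul_left_comm])
    (fun v w w' => by
      rw [← integral_add (hi v w) (hi v w')]
      simp only [map_add, inner_add_right, mul_add])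
    (fun c v w => by
      rw [RingHom.id_apply, smul_eq_mul, ← integral_const_mul]
      simp only [map_smul, inner_smul_right, mul_left_comm])
  let B' : H →L⋆[ℂ] H →L[ℂ] ℂ := B.mkContinuous₂ (|M| * ‖ν Set.univ‖) fun v w => by
    change ‖∫ x, h x * ⟪v, D x w⟫_ℂ ∂(ν.scalar ρ)‖ ≤ _
    have h1 : ‖∫ x, h x * ⟪v, D x w⟫_ℂ ∂(ν.scalar ρ)‖
        ≤ ∫ x, |M| * ‖⟪v, D x w⟫_ℂ‖ ∂(ν.scalar ρ) :=
      norm_integral_le_of_norm_le ((hD.integrable_inner v w).norm.const_mul _)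
        (ae_of_all _ fun x => by
          rw [norm_mul]
          exact mul_le_mul_of_nonneg_right ((hM x).trans (le_abs_self M)) (norm_nonneg _))
    rw [integral_const_mul] at h1
    refine h1.trans ?_
    rw [mul_assoc, mul_assoc, ← mul_assoc ‖ν Set.univ‖]
    exact mul_le_mul_of_nonneg_left (hD.integral_norm_inner_le v w) (abs_nonneg M)
  refine ⟨ContinuousLinearMap.adjoint (InnerProductSpace.continuousLinearMapOfBilin B'),
    fun v w => ?_⟩
  rw [ContinuousLinearMap.adjoint_inner_right, InnerProductSpace.continuousLinearMapOfBilin_apply]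
  rfl

theorem inner_apply_eq_integral_indicator [TopologicalSpace.SeparableSpace H]
    (hD : IsRNDeriv ν ρ D) {E : Set X} (hE : MeasurableSet E) (v w : H) :
    ⟪v, ν E w⟫_ℂ = ∫ x, E.indicator 1 x * ⟪v, D x w⟫_ℂ ∂(ν.scalar ρ) := by
  obtain ⟨A, hA⟩ := hD.exists_inner_eq_integral (h := E.indicator 1)
    (measurable_one.indicator hE) (M := 1) fun x => by
      by_cases hx : x ∈ E <;> simp [hx]
  have : ν E = A := ext_of_inner_basis e fun i j => by
    rw [hA, hD.setIntegral_eq i j E hE, ← integral_indicator hE]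
    congr 1
    funext x
    by_cases hx : x ∈ E <;> simp [hx]
  rw [this, hA]

/-- The trace formula for positive operators of finite trace. -/
theorem integrable_trace_of_nonneg [TopologicalSpace.SeparableSpace H] (hD : IsRNDeriv ν ρ D)
    {T : H →L[ℂ] H} (hT : 0 ≤ T) (hs : Summable fun i => ⟪e i, T (e i)⟫_ℂ) :
    Integrable (fun x => trace e (T * D x)) (ν.scalar ρ) ∧
      ∀ (h : X → ℂ) (_ : Measurable h) (M : ℝ) (_ : ∀ x, ‖h x‖ ≤ M) (A : H →L[ℂ] H),
        (∀ v w, ⟪v, A w⟫_ℂ = ∫ x, h x * ⟪v, D x w⟫_ℂ ∂(ν.scalar ρ)) →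
        trace e (T * A) = ∫ x, h x * trace e (T * D x) ∂(ν.scalar ρ) := by
  have := countable_of_hilbertBasis e
  -- With `b j = T^{1/2} e_j` one has `tr(T A) = ∑ ⟨b j, A b j⟩`, and `∑ ‖b j‖² = tr T` is finite;
  -- this dominates the series of integrals and justifies exchanging sum and integral.
  let b : ι → H := fun j => CFC.sqrt T (e j)
  have htr : ∀ A : H →L[ℂ] H, HasSum (fun j => ⟪b j, A (b j)⟫_ℂ) (trace e (T * A)) := fun A => by
    obtain ⟨t, h1, h2⟩ := exists_hasSum_pos e hT hs A
    rw [trace, h1.tsum_eq]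
    exact h2
  have hb : Summable fun j => ‖ν Set.univ‖ * ‖b j‖ ^ 2 := by
    refine Summable.mul_left _ (hs.norm.congr fun j => ?_)
    rw [norm_sqrt_sq hT]
  have hsum : Summable fun j => ∫ x, ‖⟪b j, D x (b j)⟫_ℂ‖ ∂(ν.scalar ρ) :=
    hb.of_nonneg_of_le (fun j => integral_nonneg fun x => norm_nonneg _)
      fun j => hD.integral_norm_inner_self_le (b j)
  refine ⟨⟨?_, ?_⟩, fun h hm M hM A hA => ?_⟩
  · exact aestronglyMeasurable_of_tendsto_ae (atTop : Filter (Finset ι))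
      (fun s => (integrable_finsetSum s fun j _ =>
        hD.integrable_inner_self (b j)).aestronglyMeasurable)
      (ae_of_all _ fun x => htr (D x))
  · calc ∫⁻ x, ‖trace e (T * D x)‖ₑ ∂(ν.scalar ρ)
        ≤ ∫⁻ x, ∑' j, ‖⟪b j, D x (b j)⟫_ℂ‖ₑ ∂(ν.scalar ρ) := lintegral_mono fun x => by
          rw [← (htr (D x)).tsum_eq]
          exact enorm_tsum_le_tsum_enorm
      _ = ∑' j, ∫⁻ x, ‖⟪b j, D x (b j)⟫_ℂ‖ₑ ∂(ν.scalar ρ) :=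
          lintegral_tsum fun j => (hD.aestronglyMeasurable_inner _ _).enorm
      _ ≤ ∑' j, ENNReal.ofReal (‖ν Set.univ‖ * ‖b j‖ ^ 2) :=
          ENNReal.tsum_le_tsum fun j => hD.lintegral_enorm_inner_self_le (b j)
      _ < ⊤ := by
          rw [← ENNReal.ofReal_tsum_of_nonneg (fun j => by positivity) hb]
          exact ENNReal.ofReal_lt_top
  · have h1 := hasSum_integral_of_summable_integral_norm
      (fun j => hD.integrable_mul_inner hm hM (b j) (b j))
      ((hsum.mul_left |M|).of_nonneg_of_le (fun j => integral_nonneg fun x => norm_nonneg _)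
        fun j => by
          rw [← integral_const_mul]
          refine integral_mono (hD.integrable_mul_inner hm hM (b j) (b j)).norm
            ((hD.integrable_inner_self (b j)).norm.const_mul _) fun x => ?_
          change ‖h x * _‖ ≤ _
          rw [norm_mul]
          exact mul_le_mul_of_nonneg_right ((hM x).trans (le_abs_self M)) (norm_nonneg _))
    have h2 := htr A
    simp only [hA] at h2
    rw [h2.unique h1]
    congr 1
    funext x
    exact ((htr (D x)).mul_left (h x)).tsum_eq

/-- Everything is linear in `T`, and positive operators of finite trace span the trace class. -/
theorem integrable_trace_and_trace_eq [TopologicalSpace.SeparableSpace H] (hD : IsRNDeriv ν ρ D)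
    {T : H →L[ℂ] H} (hT : T ∈ traceClass e) :
    Integrable (fun x => trace e (T * D x)) (ν.scalar ρ) ∧
      ∀ (h : X → ℂ) (_ : Measurable h) (M : ℝ) (_ : ∀ x, ‖h x‖ ≤ M) (A : H →L[ℂ] H),
        (∀ v w, ⟪v, A w⟫_ℂ = ∫ x, h x * ⟪v, D x w⟫_ℂ ∂(ν.scalar ρ)) →
        trace e (T * A) = ∫ x, h x * trace e (T * D x) ∂(ν.scalar ρ) := by
  induction hT using Submodule.span_induction with
  | mem T hT => exact hD.integrable_trace_of_nonneg hT.1 hT.2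
  | zero => simp [trace]
  | add S T hS hT h1 h2 =>
    simp only [trace_add_mul e hS hT]
    refine ⟨h1.1.add h2.1, fun h hm M hM A hA => ?_⟩
    rw [h1.2 h hm M hM A hA, h2.2 h hm M hM A hA, ← integral_add
      (h1.1.bdd_mul hm.aestronglyMeasurable (ae_of_all _ hM))
      (h2.1.bdd_mul hm.aestronglyMeasurable (ae_of_all _ hM))]
    simp only [mul_add]
  | smul c T hT h1 =>
    simp only [trace_smul_mul e]
    refine ⟨h1.1.const_mul _, fun h hm M hM A hA => ?_⟩
    rw [h1.2 h hm M hM A hA, ← integral_const_mul]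
    simp only [mul_left_comm]

end IsRNDeriv

/-! ### Integrals of scalar functions and the range of `ν` -/

section Range

variable {ι H X : Type*} [NormedAddCommGroup H] [InnerProductSpace ℂ H] [CompleteSpace H]
  [TopologicalSpace.SeparableSpace H] [MeasurableSpace X] {e : HilbertBasis ι ℂ H}
  {ν : POVM X e} {ρ : State e} {D : X → (H →L[ℂ] H)}

theorem smul_one_nonneg {t : ℝ} (ht : 0 ≤ t) : 0 ≤ (t : ℂ) • (1 : H →L[ℂ] H) :=
  nonneg_of_inner_self_nonneg fun v => by
    rw [smul_apply, one_apply_eq_self, inner_smul_right]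
    exact mul_nonneg (Complex.zero_le_real.2 ht) (inner_self_nonneg_of_nonneg zero_le_one v)

theorem sandwich_smul_one (s : State e) (f : X → ℂ) {x : X} (hx : 0 ≤ D x) :
    sandwich D s (fun x => f x • 1) x = f x * trace e (s.op * D x) := by
  rw [sandwich, mul_smul_comm, mul_one, smul_mul_assoc, CFC.sqrt_mul_sqrt_self _ hx,
    trace_mul_smul]

theorem IsRNDeriv.integral_sandwich_smul_one (hD : IsRNDeriv ν ρ D) (s : State e) (f : X → ℂ) :
    ∫ x, sandwich D s (fun x => f x • 1) x ∂(ν.scalar ρ)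
      = ∫ x, f x * trace e (s.op * D x) ∂(ν.scalar ρ) := by
  refine integral_congr_ae ?_
  filter_upwards [hD.ae_nonneg] with x hx
  exact sandwich_smul_one s f hx

theorem IsRNDeriv.integrable_trace_state (hD : IsRNDeriv ν ρ D) (s : State e) :
    Integrable (fun x => trace e (s.op * D x)) (ν.scalar ρ) :=
  (hD.integrable_trace_and_trace_eq s.mem_traceClass).1

theorem IsRNDeriv.ae_trace_nonneg (hD : IsRNDeriv ν ρ D) (s : State e) :
    ∀ᵐ x ∂(ν.scalar ρ), 0 ≤ trace e (s.op * D x) := by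
  filter_upwards [hD.ae_nonneg] with x hx
  exact trace_nonneg e s.nonneg s.hasSum_one.summable hx

theorem norm_ofReal_le_one_of_mem_Icc {t : ℝ} (ht : t ∈ Set.Icc (0 : ℝ) 1) : ‖(t : ℂ)‖ ≤ 1 := by
  rw [Complex.norm_real]
  exact abs_le_one_of_mem_Icc ht

/-- As `h I ≥ 0`, it is its own positive real part and the other three parts vanish, so
integrability reduces to that of `tr(s D)`. -/
theorem hasQIntegral_smul_one_iff (hD : IsRNDeriv ν ρ D) {h : X → ℝ} (hm : Measurable h)
    (h01 : ∀ x, h x ∈ Set.Icc (0 : ℝ) 1) (A : H →L[ℂ] H) :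
    HasQIntegral ν ρ D (fun x => (h x : ℂ) • 1) A ↔
      ∀ s : State e, trace e (s.op * A) = ∫ x, (h x : ℂ) * trace e (s.op * D x) ∂(ν.scalar ρ) := by
  have hmc : Measurable fun x => (h x : ℂ) := Complex.measurable_ofReal.comp hm
  have hpos : ∀ x, 0 ≤ (h x : ℂ) • (1 : H →L[ℂ] H) := fun x => smul_one_nonneg (h01 x).1
  constructor
  · intro hA s
    rw [hA.trace_eq s, hD.integral_sandwich_smul_one]
  · intro hA
    have hzero : PosIntegrable ν ρ D fun _ => 0 := fun s => by
      have : sandwich D s (fun _ => 0) = fun _ => 0 := by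
        funext x
        simp [sandwich, trace]
      rw [this]
      exact integrable_zero _ _ _
    have hre : ∀ x, (ℜ ((h x : ℂ) • (1 : H →L[ℂ] H)) : H →L[ℂ] H) = (h x : ℂ) • 1 := fun x =>
      (hpos x).isSelfAdjoint.coe_realPart
    have him : ∀ x, (ℑ ((h x : ℂ) • (1 : H →L[ℂ] H)) : H →L[ℂ] H) = 0 := fun x => by
      rw [(hpos x).isSelfAdjoint.imaginaryPart]
      rfl
    refine ⟨fun s => ?_, ⟨?_, ?_, ?_, ?_⟩, fun s => ?_⟩
    · simp only [trace_mul_smul, mul_one]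
      exact hmc.mul_const _
    · simp only [hre, (CFC.posPart_eq_self _).2 (hpos _)]
      intro s
      refine ((hD.integrable_trace_state s).bdd_mul hmc.aestronglyMeasurable (c := 1)
        (ae_of_all _ fun x => norm_ofReal_le_one_of_mem_Icc (h01 x))).congr ?_
      filter_upwards [hD.ae_nonneg] with x hx
      exact (sandwich_smul_one s (fun x => (h x : ℂ)) hx).symm
    · simp only [hre, (CFC.negPart_eq_zero_iff _ (hpos _).isSelfAdjoint).2 (hpos _)]
      exact hzero
    · simp only [him, CFC.posPart_zero]
      exact hzero
    · simp only [him, CFC.negPart_zero]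
      exact hzero
    · rw [hA s, hD.integral_sandwich_smul_one]

/-- The integral of a function with values in `[0, 1]` exists, and computes the pairing with every
trace class operator. -/
theorem exists_trace_eq_integral (hD : IsRNDeriv ν ρ D) {h : X → ℝ} (hm : Measurable h)
    (h01 : ∀ x, h x ∈ Set.Icc (0 : ℝ) 1) :
    ∃ A : H →L[ℂ] H, ∀ T ∈ traceClass e,
      trace e (T * A) = ∫ x, (h x : ℂ) * trace e (T * D x) ∂(ν.scalar ρ) := by
  have hmc : Measurable fun x => (h x : ℂ) := Complex.measurable_ofReal.comp hm
  have hb := fun x => norm_ofReal_le_one_of_mem_Icc (h01 x)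
  obtain ⟨A, hA⟩ := hD.exists_inner_eq_integral hmc hb
  exact ⟨A, fun T hT => (hD.integrable_trace_and_trace_eq hT).2 _ hmc 1 hb A hA⟩

theorem trace_mul_apply_eq_setIntegral (hD : IsRNDeriv ν ρ D) {T : H →L[ℂ] H}
    (hT : T ∈ traceClass e) {E : Set X} (hE : MeasurableSet E) :
    trace e (T * ν E) = ∫ x in E, trace e (T * D x) ∂(ν.scalar ρ) := by
  rw [(hD.integrable_trace_and_trace_eq hT).2 (E.indicator 1) (measurable_one.indicator hE) 1
    (fun x => by by_cases hx : x ∈ E <;> simp [hx]) (ν E)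
    (hD.inner_apply_eq_integral_indicator hE), ← integral_indicator hE]
  congr 1
  funext x
  by_cases hx : x ∈ E <;> simp [hx]

/-- A real bounded function which is not almost everywhere zero, is supported in a given set of
positive measure and integrates to zero against every `x ↦ tr(s D(x))`. -/
theorem ClassicallyNonInjective.exists_integral_eq_zero (hρ : ρ.FullRank)
    (hD : IsRNDeriv ν ρ D) (hinj : ClassicallyNonInjective ν ρ D) {E : Set X}
    (hE : MeasurableSet E) (hE0 : ν.scalar ρ E ≠ 0) :
    ∃ u : X → ℝ, Measurable u ∧ (∃ M, ∀ x, |u x| ≤ M) ∧ (∀ x, x ∉ E → u x = 0) ∧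
      ¬ u =ᵐ[ν.scalar ρ] 0 ∧
      ∀ s : State e, ∫ x, u x * (trace e (s.op * D x)).re ∂(ν.scalar ρ) = 0 := by
  obtain ⟨f, g, hf, hg, hfg, A, hfA, hgA⟩ :=
    hinj E hE fun h => hE0 ((ν.scalar_eq_zero_iff hρ hE).2 h)
  obtain ⟨Mf, hMf⟩ := hf.essBounded
  obtain ⟨Mg, hMg⟩ := hg.essBounded
  rw [← ν.scalar_eq_zero_iff hρ (measurableSet_lt measurable_const hf.measurable.norm)] at hMf
  rw [← ν.scalar_eq_zero_iff hρ (measurableSet_lt measurable_const hg.measurable.norm)] at hMg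
  have hne : MeasurableSet {x | f x ≠ g x} :=
    (measurableSet_eq_fun hf.measurable hg.measurable).compl
  rw [Ne, ← ν.scalar_eq_zero_iff hρ hne] at hfg
  -- `f` and `g` are only essentially bounded, so their difference is cut down to a conull set where
  -- both bounds hold.
  let G : Set X := {x | ‖f x‖ ≤ Mf} ∩ {x | ‖g x‖ ≤ Mg}
  have hG : MeasurableSet G := (measurableSet_le hf.measurable.norm measurable_const).inter
    (measurableSet_le hg.measurable.norm measurable_const)
  have hGae : ∀ᵐ x ∂(ν.scalar ρ), x ∈ G := by
    have h1 : ∀ᵐ x ∂(ν.scalar ρ), ‖f x‖ ≤ Mf := by simpa only [ae_iff, not_le] using hMf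
    have h2 : ∀ᵐ x ∂(ν.scalar ρ), ‖g x‖ ≤ Mg := by simpa only [ae_iff, not_le] using hMg
    filter_upwards [h1, h2] with x h1 h2
    exact ⟨h1, h2⟩
  let k : X → ℂ := G.indicator fun x => f x - g x
  have km : Measurable k := (hf.measurable.sub hg.measurable).indicator hG
  have kM : ∀ x, ‖k x‖ ≤ |Mf| + |Mg| := fun x => by
    by_cases hx : x ∈ G
    · simp only [k, Set.indicator_of_mem hx]
      exact (norm_sub_le _ _).trans
        (add_le_add (hx.1.trans (le_abs_self _)) (hx.2.trans (le_abs_self _)))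
    · simp only [k, Set.indicator_of_notMem hx, norm_zero]
      positivity
  have kE : ∀ x, x ∉ E → k x = 0 := fun x hx => by
    simp [k, hf.eq_zero x hx, hg.eq_zero x hx]
  have kint : ∀ s : State e, ∫ x, k x * trace e (s.op * D x) ∂(ν.scalar ρ) = 0 := fun s => by
    have hint : ∀ (f : X → ℂ) (_ : Measurable f) (M : ℝ), (∀ᵐ x ∂(ν.scalar ρ), ‖f x‖ ≤ M) →
        Integrable (fun x => f x * trace e (s.op * D x)) (ν.scalar ρ) := fun f hf M hM =>
      (hD.integrable_trace_state s).bdd_mul hf.aestronglyMeasurable hM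
    have h1 : ∫ x, f x * trace e (s.op * D x) ∂(ν.scalar ρ)
        = ∫ x, g x * trace e (s.op * D x) ∂(ν.scalar ρ) := by
      rw [← hD.integral_sandwich_smul_one, ← hfA.trace_eq, hgA.trace_eq,
        hD.integral_sandwich_smul_one]
    rw [← sub_eq_zero, ← integral_sub
      (hint f hf.measurable Mf (hGae.mono fun x hx => hx.1))
      (hint g hg.measurable Mg (hGae.mono fun x hx => hx.2))] at h1
    rw [← h1]
    refine integral_congr_ae ?_
    filter_upwards [hGae] with x hx
    simp only [k, Set.indicator_of_mem hx, sub_mul]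
  have kne : ¬ k =ᵐ[ν.scalar ρ] 0 := fun h0 => by
    refine hfg ?_
    rw [← compl_mem_ae_iff]
    filter_upwards [h0, hGae] with x hx hxG
    simp only [k, Set.indicator_of_mem hxG, Pi.zero_apply] at hx
    simpa using sub_eq_zero.1 hx
  have kre : ∀ s : State e, Integrable (fun x => k x * trace e (s.op * D x)) (ν.scalar ρ) :=
    fun s => (hD.integrable_trace_state s).bdd_mul km.aestronglyMeasurable (ae_of_all _ kM)
  have htr : ∀ s : State e, ∀ᵐ x ∂(ν.scalar ρ),
      trace e (s.op * D x) = ((trace e (s.op * D x)).re : ℂ) := fun s => by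
    filter_upwards [hD.ae_trace_nonneg s] with x hx
    exact Complex.ext rfl (Complex.nonneg_iff.1 hx).2.symm
  -- One of the real and imaginary parts of `k` is not null, and both integrate to zero because
  -- `tr(s D)` is real almost everywhere.
  by_cases h : (fun x => (k x).re) =ᵐ[ν.scalar ρ] 0
  · refine ⟨fun x => (k x).im, Complex.measurable_im.comp km,
      ⟨_, fun x => (Complex.abs_im_le_norm _).trans (kM x)⟩, fun x hx => by simp [kE x hx],
      fun h' => kne ?_, fun s => ?_⟩
    · filter_upwards [h, h'] with x h1 h2
      exact Complex.ext h1 h2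
    · have h1 := integral_im (kre s)
      rw [kint, map_zero] at h1
      rw [← h1]
      refine integral_congr_ae ?_
      filter_upwards [htr s] with x hx
      rw [RCLike.im_to_complex, hx, Complex.im_mul_ofReal, Complex.ofReal_re]
  · refine ⟨fun x => (k x).re, Complex.measurable_re.comp km,
      ⟨_, fun x => (Complex.abs_re_le_norm _).trans (kM x)⟩, fun x hx => by simp [kE x hx],
      h, fun s => ?_⟩
    have h1 := integral_re (kre s)
    rw [kint, map_zero] at h1
    rw [← h1]
    refine integral_congr_ae ?_
    filter_upwards [htr s] with x hx
    rw [RCLike.re_to_complex, hx, Complex.re_mul_ofReal, Complex.ofReal_re]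

theorem IsRNDeriv.ofReal_integral_re (hD : IsRNDeriv ν ρ D) (s : State e) (h : X → ℝ) :
    ∫ x, (h x : ℂ) * trace e (s.op * D x) ∂(ν.scalar ρ)
      = ((∫ x, h x * (trace e (s.op * D x)).re ∂(ν.scalar ρ) : ℝ) : ℂ) := by
  rw [← integral_complex_ofReal]
  refine integral_congr_ae ?_
  filter_upwards [hD.ae_trace_nonneg s] with x hx
  rw [Complex.ofReal_mul]
  congr 1
  exact Complex.ext rfl (Complex.nonneg_iff.1 hx).2.symm

/-- The range of `ν` consists of the integrals of the functions with values in `[0, 1]`. -/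
theorem range_eq (hρ : ρ.FullRank) (hD : IsRNDeriv ν ρ D)
    (hinj : ClassicallyNonInjective ν ρ D) :
    {A : H →L[ℂ] H | ∃ E, MeasurableSet E ∧ ν E = A} =
      {A : H →L[ℂ] H | ∃ h : X → ℝ, Measurable h ∧ (∀ x, h x ∈ Set.Icc (0 : ℝ) 1) ∧
        ∀ T ∈ traceClass e,
          trace e (T * A) = ∫ x, (h x : ℂ) * trace e (T * D x) ∂(ν.scalar ρ)} := by
  ext A
  constructor
  · rintro ⟨E, hE, rfl⟩
    refine ⟨E.indicator 1, measurable_one.indicator hE, fun x => ?_, fun T hT => ?_⟩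
    · by_cases hx : x ∈ E <;> simp [hx]
    · rw [trace_mul_apply_eq_setIntegral hD hT hE, ← integral_indicator hE]
      congr 1
      funext x
      by_cases hx : x ∈ E <;> simp [hx]
  · rintro ⟨h, hm, h01, hA⟩
    -- The scalar theorem is applied to the family `tr(s D)` over all states `s`, which suffices
    -- since states separate operators.
    obtain ⟨E, hE, hEs⟩ := exists_setIntegral_eq
      (d := fun (s : State e) x => (trace e (s.op * D x)).re)
      (fun s => (hD.integrable_trace_state s).re)
      (fun E hE hE0 => hinj.exists_integral_eq_zero hρ hD hE hE0) hm h01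
    refine ⟨E, hE, eq_of_trace_state_mul_eq e fun s => ?_⟩
    rw [hA _ s.mem_traceClass, hD.ofReal_integral_re, ← hEs,
      trace_mul_apply_eq_setIntegral hD s.mem_traceClass hE, ← integral_complex_ofReal]
    refine integral_congr_ae (ae_restrict_of_ae ?_)
    filter_upwards [hD.ae_trace_nonneg s] with x hx
    exact Complex.ext rfl (Complex.nonneg_iff.1 hx).2.symm

theorem convex_integrals (hD : IsRNDeriv ν ρ D) :
    Convex ℝ {A : H →L[ℂ] H | ∃ h : X → ℝ, Measurable h ∧ (∀ x, h x ∈ Set.Icc (0 : ℝ) 1) ∧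
      ∀ T ∈ traceClass e,
        trace e (T * A) = ∫ x, (h x : ℂ) * trace e (T * D x) ∂(ν.scalar ρ)} := by
  rintro A ⟨h, hm, h01, hA⟩ B ⟨g, gm, g01, hB⟩ a b ha hb hab
  refine ⟨fun x => a * h x + b * g x, (hm.const_mul a).add (gm.const_mul b),
    fun x => (convex_Icc (0 : ℝ) 1) (h01 x) (g01 x) ha hb hab, fun T hT => ?_⟩
  have hint : ∀ {h : X → ℝ} (_ : Measurable h) (_ : ∀ x, h x ∈ Set.Icc (0 : ℝ) 1),
      Integrable (fun x => (h x : ℂ) * trace e (T * D x)) (ν.scalar ρ) := fun hm h01 =>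
    (hD.integrable_trace_and_trace_eq hT).1.bdd_mul
      (Complex.measurable_ofReal.comp hm).aestronglyMeasurable
      (ae_of_all _ fun x => norm_ofReal_le_one_of_mem_Icc (h01 x))
  have hs : ∀ (c : ℝ) (A : H →L[ℂ] H), c • A = (c : ℂ) • A := fun c A =>
    (RCLike.real_smul_eq_coe_smul (K := ℂ) c A)
  rw [hs, hs, trace_mul_add e hT, trace_mul_smul, trace_mul_smul, hA T hT, hB T hT,
    ← integral_const_mul, ← integral_const_mul,
    ← integral_add ((hint hm h01).const_mul _) ((hint gm g01).const_mul _)]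
  congr 1
  funext x
  push_cast
  ring

/-- The ultraweak topology is induced by the pairings into a product of copies of `ℂ`, so
compactness may be checked on the image there. That image is all of the compact set of integrals
because every `h` has an operator integral. -/
theorem isCompact_ultraweak_integrals (hD : IsRNDeriv ν ρ D) :
    @IsCompact _ (ultraweak e)
      {A : H →L[ℂ] H | ∃ h : X → ℝ, Measurable h ∧ (∀ x, h x ∈ Set.Icc (0 : ℝ) 1) ∧
        ∀ T ∈ traceClass e,
          trace e (T * A) = ∫ x, (h x : ℂ) * trace e (T * D x) ∂(ν.scalar ρ)} := by
  let Φ : (H →L[ℂ] H) → traceClass e → ℂ := fun A T => trace e ((T : H →L[ℂ] H) * A)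
  have hΦ : @Topology.IsInducing _ _ (ultraweak e) _ Φ := by
    refine @Topology.IsInducing.mk _ _ (ultraweak e) _ _ ?_
    rw [Pi.topologicalSpace, induced_iInf]
    simp only [induced_compose]
    rfl
  rw [@Topology.IsInducing.isCompact_iff _ _ (ultraweak e) _ _ _ hΦ]
  convert isCompact_integrals (μ := ν.scalar ρ)
    (d := fun (T : traceClass e) x => trace e ((T : H →L[ℂ] H) * D x))
    (fun T => (hD.integrable_trace_and_trace_eq T.2).1) using 1
  ext c
  constructor
  · rintro ⟨A, ⟨h, hm, h01, hA⟩, rfl⟩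
    exact ⟨h, hm, h01, fun T => hA T T.2⟩
  · rintro ⟨h, hm, h01, hc⟩
    obtain ⟨A, hA⟩ := exists_trace_eq_integral hD hm h01
    exact ⟨A, ⟨h, hm, h01, hA⟩, funext fun T => (hA T T.2).trans (hc T).symm⟩

/-- For the integral of a function with values in `[0, 1]` it is equivalent to test against states
and against trace class operators. -/
theorem hasQIntegral_smul_one_iff_forall_traceClass (hD : IsRNDeriv ν ρ D) {h : X → ℝ}
    (hm : Measurable h) (h01 : ∀ x, h x ∈ Set.Icc (0 : ℝ) 1) (A : H →L[ℂ] H) :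
    HasQIntegral ν ρ D (fun x => (h x : ℂ) • 1) A ↔ ∀ T ∈ traceClass e,
      trace e (T * A) = ∫ x, (h x : ℂ) * trace e (T * D x) ∂(ν.scalar ρ) := by
  rw [hasQIntegral_smul_one_iff hD hm h01]
  refine ⟨fun hA => ?_, fun hA s => hA _ s.mem_traceClass⟩
  obtain ⟨B, hB⟩ := exists_trace_eq_integral hD hm h01
  have : A = B := eq_of_trace_state_mul_eq e fun s => by rw [hA, hB _ s.mem_traceClass]
  rwa [this]

end Range

end OperatorMeasure

theorem theorem3p1 {ι H X : Type*} [NormedAddCommGroup H] [InnerProductSpace ℂ H]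
    [CompleteSpace H] [TopologicalSpace.SeparableSpace H] [MeasurableSpace X]
    (e : HilbertBasis ι ℂ H) (ν : OperatorMeasure.POVM X e) (hν : ν.Nonatomic)
    (ρ : OperatorMeasure.State e) (hρ : ρ.FullRank)
    (D : X → (H →L[ℂ] H)) (hD : OperatorMeasure.IsRNDeriv ν ρ D)
    (hinj : OperatorMeasure.ClassicallyNonInjective ν ρ D) :
    Convex ℝ {A : H →L[ℂ] H | ∃ E, MeasurableSet E ∧ ν E = A} ∧
    @IsCompact _ (OperatorMeasure.ultraweak e) {A : H →L[ℂ] H | ∃ E, MeasurableSet E ∧ ν E = A} ∧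
    (∀ h : X → ℝ, Measurable h → (∀ x, h x ∈ Set.Icc (0 : ℝ) 1) →
      ∃! A : H →L[ℂ] H, OperatorMeasure.HasQIntegral ν ρ D (fun x => (h x : ℂ) • 1) A) ∧
    {A : H →L[ℂ] H | ∃ E, MeasurableSet E ∧ ν E = A} =
      {A : H →L[ℂ] H | ∃ h : X → ℝ, Measurable h ∧ (∀ x, h x ∈ Set.Icc (0 : ℝ) 1) ∧
        OperatorMeasure.HasQIntegral ν ρ D (fun x => (h x : ℂ) • 1) A} := by
  have hr := OperatorMeasure.range_eq hρ hD hinj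
  refine ⟨?_, ?_, fun h hm h01 => ?_, ?_⟩
  · rw [hr]
    exact OperatorMeasure.convex_integrals hD
  · rw [hr]
    exact OperatorMeasure.isCompact_ultraweak_integrals hD
  · obtain ⟨A, hA⟩ := OperatorMeasure.exists_trace_eq_integral hD hm h01
    have hiff := OperatorMeasure.hasQIntegral_smul_one_iff_forall_traceClass hD hm h01
    refine ⟨A, (hiff A).2 hA, fun B hB => OperatorMeasure.eq_of_trace_state_mul_eq e fun s => ?_⟩
    rw [(hiff B).1 hB _ s.mem_traceClass, hA _ s.mem_traceClass]
  · rw [hr]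
    ext A
    refine exists_congr fun h => and_congr_right fun hm => and_congr_right fun h01 => ?_
    exact (OperatorMeasure.hasQIntegral_smul_one_iff_forall_traceClass hD hm h01 A).symm
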